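/- Let $l>0$, $m>0$. For $\hbar,\alpha>0$ and $(q,p)\in\mathbb R^2$ put $$\eta_{qp}(x)=\frac{1}{\sqrt[4]{2\pi\alpha^2}}\exp\Big\{-\frac{(x-q)^2}{4\alpha^2}+\frac{ip(x-q)}{\hbar}\Big\},\qquad \upsilon_{qp}(x)=\sum_{n\in\mathbb Z}\eta_{qp}(x-2nl)\in L_2(-l,l),$$ the coherent states on the circle $[-l,l]$ (with $\pm l$ identified). Let $H=-\frac{\hbar^2}{2m}\frac{d^2}{dx^2}$ with periodic boundary conditions on $L_2(-l,l)$, let $\upsilon_{qp,t}=e^{-itH/\hbar}\upsilon_{qp}$, and let $(\cdot,\cdot)$ be the scalar product of $L_2(-l,l)$. Put $T_{rev}=\frac{4ml^2}{\pi\hbar}$ and $\Omega=[-l,l]\times\mathbb R$. Let $\mathscr S(K)$ be the space of real functions $\sigma\in C^\infty(\mathbb R^2)$ with $\sigma(q+2nl,p)=\sigma(q,p)$ for all $n\in\mathbb Z$, all of whose partial derivatives decay, uniformly in $q$, faster than any power of $p$ as $p\to\pm\infty$, with the topology of the seminorms $$P_N(\sigma)=\max_{s_1+s_2\le N}\sup_{\mathbb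 R^2}(1+p^2)^{N/2}\Big|\frac{\partial^{s_1+s_2}\sigma}{\partial q^{s_1}\partial p^{s_2}}\Big|,\quad N=0,1,2,\dots,$$ and let $\mathscr S'(K)$ be the space of continuous linear functionals on $\mathscr S(K)$ (with pointwise convergence). A function $f(q',p')$ is regarded as the functional $\sigma\mapsto\iint_\Omega f\sigma\,dq'dp'$. For $s,p\in\mathbb R$ and $D\in[0,\infty]$ the element $\varphi_D(q'-s)\,\delta(p'-p)$ of $\mathscr S'(K)$ is $$\sigma\mapsto\int_{-\infty}^{\infty}\frac{1}{\sqrt{2\pi D^2}}e^{-(q'-s)^2/(2D^2)}\sigma(q',p)\,dq'\ \ (0<D<\infty),\qquad \sigma\mapsto\sigma(s,p)\ \ (D=0),\qquad \sigma\mapsto\frac1{2l}\int_{-l}^{l}\sigma(q',p)\,dq'\ \ (D=\infty);$$ the last one is also written $\frac1{2l}\delta(p'-p)$. **Theorem.** Let $c\in\mathbb R$ and $D\in[0,\infty]$, and let $\hbar>0$, $\alpha>0$ and $t\in\mathbb R$ vary so that $$\hbar\to0,\quad \alpha\to0,\quad \frac{\hbar}{\alpha}\to0,\quad \frac{\hbar}{\alpha}(t-cT_{rev})\to2mD,\quad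 \hbar\,(t-cT_{rev})\to0 .$$ Then for all $(q,p)$ the function $(q',p')\mapsto\frac1{2\pi\hbar}|(\upsilon_{qp},\upsilon_{q'p',t})|^2$ defines an element of $\mathscr S'(K)$, and, in $\mathscr S'(K)$ with respect to the variables $(q',p')$, the following holds. 1) If $c=\frac MN$ is rational (a reduced fraction, $N\ge1$), then $$\lim\Big\{\frac{1}{2\pi\hbar}|(\upsilon_{qp},\upsilon_{q'p',t})|^2-\frac1{N'}\sum_{k=0}^{N'-1}\varphi_D\Big[q'-q-\frac{2kl}{N'}-a+\frac pm(t-cT_{rev})\Big]\delta(p'-p)\Big\}=0,$$ where $N'=N$ for odd $N$, $N'=\frac N2$ for even $N$, $a=\frac{2l}{N}$ if $N\equiv2\pmod 4$, and $a=0$ otherwise. 2) If $c$ is irrational, then $$\lim\Big\{\frac{1}{2\pi\hbar}|(\upsilon_{qp},\upsilon_{q'p',t})|^2-\frac1{2l}\,\delta(p'-p)\Big\}=0 .$$ In both cases the convergence is uniform with respect to $(q,p)\in\Omega$: for every $\sigma\in\mathscr S(K)$ the pairing of the expression in braces with $\sigma$ tends to $0$ uniformly in $(q,p)\in\Omega$.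 -/

import Mathlib

open MeasureTheory Filter Topology
open scoped ENNReal ContDiff InnerProductSpace

noncomputable section

namespace CircleCoherent

/-! ### Test functions and distributions on the cylinder -/

/-- The partial derivative `∂/∂q` of a function of `(q, p)`. -/
def partialQ (f : ℝ × ℝ → ℝ) : ℝ × ℝ → ℝ := fun x => fderiv ℝ f x (1, 0)

/-- The partial derivative `∂/∂p` of a function of `(q, p)`. -/
def partialP (f : ℝ × ℝ → ℝ) : ℝ × ℝ → ℝ := fun x => fderiv ℝ f x (0, 1)

/-- The mixed partial derivative `∂^(s₁ + s₂) f / ∂q^s₁ ∂p^s₂`. -/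
def mixedPartial (s₁ s₂ : ℕ) (f : ℝ × ℝ → ℝ) : ℝ × ℝ → ℝ := partialQ^[s₁] (partialP^[s₂] f)

theorem contDiff_fderiv_apply {f : ℝ × ℝ → ℝ} (hf : ContDiff ℝ ∞ f) (v : ℝ × ℝ) :
    ContDiff ℝ ∞ (fun x => fderiv ℝ f x v) :=
  (hf.fderiv_right (m := ∞) (by simp)).clm_apply contDiff_const

theorem iterate_fderiv_apply (v : ℝ × ℝ) (n : ℕ) :
    (∀ f : ℝ × ℝ → ℝ, ContDiff ℝ ∞ f →
      ContDiff ℝ ∞ ((fun (h : ℝ × ℝ → ℝ) x => fderiv ℝ h x v)^[n] f)) ∧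
    (∀ f g : ℝ × ℝ → ℝ, ContDiff ℝ ∞ f → ContDiff ℝ ∞ g →
      (fun (h : ℝ × ℝ → ℝ) x => fderiv ℝ h x v)^[n] (f + g) =
        (fun (h : ℝ × ℝ → ℝ) x => fderiv ℝ h x v)^[n] f +
          (fun (h : ℝ × ℝ → ℝ) x => fderiv ℝ h x v)^[n] g) ∧
    (∀ (c : ℝ) (f : ℝ × ℝ → ℝ), ContDiff ℝ ∞ f →
      (fun (h : ℝ × ℝ → ℝ) x => fderiv ℝ h x v)^[n] (c • f) =
        c • (fun (h : ℝ × ℝ → ℝ) x => fderiv ℝ h x v)^[n] f) := by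
  induction n with
  | zero => simp
  | succ n ih =>
    obtain ⟨h1, h2, h3⟩ := ih
    refine ⟨fun f hf => ?_, fun f g hf hg => ?_, fun c f hf => ?_⟩
    · rw [Function.iterate_succ_apply]
      exact h1 _ (contDiff_fderiv_apply hf v)
    · simp only [Function.iterate_succ_apply]
      rw [← h2 _ _ (contDiff_fderiv_apply hf v) (contDiff_fderiv_apply hg v)]
      congr 1
      ext x
      simp [fderiv_add (hf.differentiable (by simp) x) (hg.differentiable (by simp) x)]
    · simp only [Function.iterate_succ_apply]
      rw [← h3 _ _ (contDiff_fderiv_apply hf v)]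
      congr 1
      ext x
      simp [fderiv_const_smul (hf.differentiable (by simp) x)]

theorem mixedPartial_add (s₁ s₂ : ℕ) {f g : ℝ × ℝ → ℝ} (hf : ContDiff ℝ ∞ f)
    (hg : ContDiff ℝ ∞ g) :
    mixedPartial s₁ s₂ (f + g) = mixedPartial s₁ s₂ f + mixedPartial s₁ s₂ g := by
  have h := iterate_fderiv_apply (0, 1) s₂
  have h' := iterate_fderiv_apply (1, 0) s₁
  unfold mixedPartial
  erw [h.2.1 f g hf hg, h'.2.1 _ _ (h.1 f hf) (h.1 g hg)]
  rfl

theorem mixedPartial_smul (s₁ s₂ : ℕ) (c : ℝ) {f : ℝ × ℝ → ℝ} (hf : ContDiff ℝ ∞ f) :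
    mixedPartial s₁ s₂ (c • f) = c • mixedPartial s₁ s₂ f := by
  have h := iterate_fderiv_apply (0, 1) s₂
  have h' := iterate_fderiv_apply (1, 0) s₁
  unfold mixedPartial
  erw [h.2.2 c f hf, h'.2.2 c _ (h.1 f hf)]
  rfl

/-- The weight `(1 + p²)^(N/2)`. -/
def weight (N : ℕ) (x : ℝ × ℝ) : ℝ := (1 + x.2 ^ 2) ^ ((N : ℝ) / 2)

theorem weight_nonneg (N : ℕ) (x : ℝ × ℝ) : 0 ≤ weight N x := by
  unfold weight; positivity

/-- Smooth real functions on the plane that are `2l`-periodic in `q` and all of whose partial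
derivatives decrease, uniformly in `q`, faster than every power of `p` as `p → ±∞` (which is the
same as: every derivative times every weight is bounded). -/
def testSubmodule (l : ℝ) : Submodule ℝ (ℝ × ℝ → ℝ) where
  carrier := {f | (∀ (n : ℤ) (q p : ℝ), f (q + 2 * n * l, p) = f (q, p)) ∧
    ContDiff ℝ ∞ f ∧
    ∀ N s₁ s₂ : ℕ, ∃ C : ℝ, ∀ x, weight N x * |mixedPartial s₁ s₂ f x| ≤ C}
  zero_mem' := by
    refine ⟨by simp, contDiff_const, fun N s₁ s₂ => ⟨0, fun x => ?_⟩⟩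
    have h := mixedPartial_smul s₁ s₂ 0 (f := (0 : ℝ × ℝ → ℝ)) contDiff_const
    simp only [zero_smul] at h
    simp [h]
  add_mem' := by
    rintro f g ⟨hf1, hf2, hf3⟩ ⟨hg1, hg2, hg3⟩
    refine ⟨fun n q p => by simp [hf1, hg1], hf2.add hg2, fun N s₁ s₂ => ?_⟩
    obtain ⟨A, hA⟩ := hf3 N s₁ s₂
    obtain ⟨B, hB⟩ := hg3 N s₁ s₂
    refine ⟨A + B, fun x => ?_⟩
    rw [mixedPartial_add s₁ s₂ hf2 hg2]
    calc weight N x * |(mixedPartial s₁ s₂ f + mixedPartial s₁ s₂ g) x|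
        ≤ weight N x * (|mixedPartial s₁ s₂ f x| + |mixedPartial s₁ s₂ g x|) :=
          mul_le_mul_of_nonneg_left (abs_add_le _ _) (weight_nonneg N x)
      _ ≤ A + B := by rw [mul_add]; exact add_le_add (hA x) (hB x)
  smul_mem' := by
    rintro c f ⟨hf1, hf2, hf3⟩
    refine ⟨fun n q p => by simp [hf1], contDiff_const.smul hf2, fun N s₁ s₂ => ?_⟩
    obtain ⟨A, hA⟩ := hf3 N s₁ s₂
    refine ⟨|c| * A, fun x => ?_⟩
    rw [mixedPartial_smul s₁ s₂ c hf2]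
    calc weight N x * |(c • mixedPartial s₁ s₂ f) x|
        = |c| * (weight N x * |mixedPartial s₁ s₂ f x|) := by
          simp only [Pi.smul_apply, smul_eq_mul, abs_mul]; ring
      _ ≤ |c| * A := mul_le_mul_of_nonneg_left (hA x) (abs_nonneg c)

/-- The space `𝒮(K)` of test functions on the cylinder `K` of circumference `2l`. -/
def TestFun (l : ℝ) : Type := testSubmodule l

instance (l : ℝ) : AddCommGroup (TestFun l) := inferInstanceAs (AddCommGroup (testSubmodule l))

instance (l : ℝ) : Module ℝ (TestFun l) := inferInstanceAs (Module ℝ (testSubmodule l))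

instance (l : ℝ) : CoeFun (TestFun l) (fun _ => ℝ × ℝ → ℝ) := ⟨Subtype.val⟩

theorem TestFun.bddAbove {l : ℝ} (N s₁ s₂ : ℕ) (σ : TestFun l) :
    BddAbove (Set.range fun x => weight N x * |mixedPartial s₁ s₂ σ x|) := by
  obtain ⟨C, hC⟩ := σ.2.2.2 N s₁ s₂
  exact ⟨C, by rintro _ ⟨x, rfl⟩; exact hC x⟩

/-- `σ ↦ sup (1 + p²)^(N/2) |∂^(s₁+s₂) σ / ∂q^s₁ ∂p^s₂|`. -/
def derivSeminorm (l : ℝ) (N s₁ s₂ : ℕ) : Seminorm ℝ (TestFun l) :=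
  Seminorm.of (fun σ => ⨆ x, weight N x * |mixedPartial s₁ s₂ σ x|)
    (fun σ τ => by
      refine ciSup_le fun x => ?_
      have e : mixedPartial s₁ s₂ (σ + τ : TestFun l) =
        mixedPartial s₁ s₂ σ + mixedPartial s₁ s₂ τ := mixedPartial_add s₁ s₂ σ.2.2.1 τ.2.2.1
      rw [e]
      calc weight N x * |(mixedPartial s₁ s₂ σ + mixedPartial s₁ s₂ τ) x|
          ≤ weight N x * (|mixedPartial s₁ s₂ σ x| + |mixedPartial s₁ s₂ τ x|) :=
            mul_le_mul_of_nonneg_left (abs_add_le _ _) (weight_nonneg N x)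
        _ ≤ _ := by
            rw [mul_add]
            exact add_le_add (le_ciSup (σ.bddAbove N s₁ s₂) x) (le_ciSup (τ.bddAbove N s₁ s₂) x))
    (fun c σ => by
      have e : mixedPartial s₁ s₂ (c • σ : TestFun l) = c • mixedPartial s₁ s₂ σ :=
        mixedPartial_smul s₁ s₂ c σ.2.2.1
      rw [e, Real.norm_eq_abs, Real.mul_iSup_of_nonneg (abs_nonneg c)]
      congr 1
      ext x
      simp only [Pi.smul_apply, smul_eq_mul, abs_mul]
      ring)

/-- The seminorms `P_N(σ) = max_{s₁+s₂≤N} sup (1 + p²)^(N/2) |∂^(s₁+s₂) σ / ∂q^s₁ ∂p^s₂|`. -/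
def testSeminorm (l : ℝ) : SeminormFamily ℝ (TestFun l) ℕ := fun N =>
  ((Finset.range (N + 1) ×ˢ Finset.range (N + 1)).filter (fun s => s.1 + s.2 ≤ N)).sup
    (fun s => derivSeminorm l N s.1 s.2)

/-- The topology of `𝒮(K)`, generated by the seminorms `P_N`. -/
instance (l : ℝ) : TopologicalSpace (TestFun l) := (testSeminorm l).moduleFilterBasis.topology'

theorem testFun_withSeminorms (l : ℝ) : WithSeminorms (testSeminorm l) := ⟨rfl⟩

/-- The space `𝒮'(K)` of distributions: continuous linear functionals on `𝒮(K)`. -/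
abbrev Distribution (l : ℝ) : Type := TestFun l →L[ℝ] ℝ

theorem TestFun.abs_le {l : ℝ} (σ : TestFun l) (x : ℝ × ℝ) : |σ x| ≤ testSeminorm l 0 σ := by
  have h : weight 0 x * |mixedPartial 0 0 σ x| ≤ ⨆ y, weight 0 y * |mixedPartial 0 0 σ y| :=
    le_ciSup (σ.bddAbove 0 0 0) x
  have h2 : derivSeminorm l 0 0 0 ≤ testSeminorm l 0 :=
    Finset.le_sup (f := fun s : ℕ × ℕ => derivSeminorm l 0 s.1 s.2) (b := (0, 0)) (by simp)
  refine le_trans ?_ (le_trans h (h2 σ))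
  simp [weight, mixedPartial]

theorem TestFun.continuous {l : ℝ} (σ : TestFun l) : Continuous σ.1 := σ.2.2.1.continuous

/-- A linear functional bounded by a multiple of `P_0` is a distribution. -/
def mkDistribution {l : ℝ} (T : TestFun l →ₗ[ℝ] ℝ) (C : ℝ)
    (hT : ∀ σ, |T σ| ≤ C * testSeminorm l 0 σ) : Distribution l where
  toLinearMap := T
  cont := by
    refine WithSeminorms.continuous_normedSpace_rng ℝ (testFun_withSeminorms l) T
      ⟨{0}, C.toNNReal, fun σ => ?_⟩
    refine (hT σ).trans ?_
    simp only [Finset.sup_singleton, smul_apply, NNReal.smul_def, smul_eq_mul,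
      Real.coe_toNNReal']
    exact mul_le_mul_of_nonneg_right (le_max_left _ _) (apply_nonneg _ _)

/-- `δ(q - q₀, p - p₀)`, that is `σ ↦ σ(q₀, p₀)`. -/
def deltaDist (l q₀ p₀ : ℝ) : Distribution l :=
  mkDistribution { toFun := fun σ => σ (q₀, p₀)
                   map_add' := fun _ _ => rfl
                   map_smul' := fun _ _ => rfl } 1
    (fun σ => by rw [one_mul]; exact σ.abs_le (q₀, p₀))

theorem TestFun.integrable_line {l : ℝ} {f : ℝ → ℝ} (hf : Integrable f) (p₀ : ℝ)
    (σ : TestFun l) : Integrable (fun q => f q * σ (q, p₀)) := by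
  have hc : Continuous fun q : ℝ => σ (q, p₀) := σ.continuous.comp (by fun_prop)
  exact hf.mul_bdd (c := testSeminorm l 0 σ) hc.aestronglyMeasurable
    (Eventually.of_forall fun q => σ.abs_le (q, p₀))

/-- `f(q) δ(p - p₀)` for an integrable `f` on the line, that is `σ ↦ ∫_ℝ f(q) σ(q, p₀) dq`. -/
def lineDist (l : ℝ) (f : ℝ → ℝ) (hf : Integrable f) (p₀ : ℝ) : Distribution l :=
  mkDistribution { toFun := fun σ => ∫ q, f q * σ (q, p₀)
                   map_add' := fun σ τ => by
                    rw [← integral_add (σ.integrable_line hf p₀) (τ.integrable_line hf p₀)]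
                    exact integral_congr_ae (Eventually.of_forall fun q => mul_add _ _ _)
                   map_smul' := fun c σ => by
                    rw [RingHom.id_apply, smul_eq_mul, ← integral_const_mul]
                    exact integral_congr_ae (Eventually.of_forall fun q =>
                      mul_left_comm _ _ _) } (∫ q, |f q|)
    (fun σ => by
      refine (abs_integral_le_integral_abs).trans ?_
      rw [← integral_mul_const]
      refine integral_mono (σ.integrable_line hf p₀).abs (hf.abs.mul_const _) fun q => ?_
      simp only [abs_mul]
      exact mul_le_mul_of_nonneg_left (σ.abs_le _) (abs_nonneg _))

/-- `c δ(p - p₀)` for a constant `c`, that is `σ ↦ c ∫_{-l}^{l} σ(q, p₀) dq`. -/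
def constDist (l c p₀ : ℝ) : Distribution l :=
  mkDistribution { toFun := fun σ => c * ∫ q in (-l)..l, σ (q, p₀)
                   map_add' := fun σ τ => by
                    have h (ρ : TestFun l) : Continuous fun q : ℝ => ρ (q, p₀) :=
                      ρ.continuous.comp (by fun_prop)
                    rw [← mul_add, ← intervalIntegral.integral_add
                      ((h σ).intervalIntegrable _ _) ((h τ).intervalIntegrable _ _)]
                    rfl
                   map_smul' := fun a σ => by
                    rw [RingHom.id_apply, smul_eq_mul, mul_left_comm]
                    exact congrArg (c * ·) (intervalIntegral.integral_const_mul a _) } (|c| * |l - -l|)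
    (fun σ => by
      have h := intervalIntegral.norm_integral_le_of_norm_le_const (a := -l) (b := l)
        (f := fun q => σ (q, p₀)) (C := testSeminorm l 0 σ) (fun q _ => σ.abs_le _)
      calc |c * ∫ q in (-l)..l, σ (q, p₀)| = |c| * |∫ q in (-l)..l, σ (q, p₀)| := abs_mul _ _
        _ ≤ |c| * (testSeminorm l 0 σ * |l - -l|) := mul_le_mul_of_nonneg_left h (abs_nonneg c)
        _ = _ := by ring)

/-- The Gaussian `φ_D(q) = (2πD²)^(-1/2) exp(-q²/(2D²))`, for `0 < D < ∞`. -/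
def gaussian (D q : ℝ) : ℝ := 1 / √(2 * Real.pi * D ^ 2) * Real.exp (-q ^ 2 / (2 * D ^ 2))

theorem integrable_gaussian (D s : ℝ) : Integrable fun q => gaussian D (q - s) := by
  rcases eq_or_ne D 0 with rfl | hD
  · simp [gaussian]
  · have h : Integrable fun q : ℝ => Real.exp (-(1 / (2 * D ^ 2)) * q ^ 2) :=
      integrable_exp_neg_mul_sq (by positivity)
    have h2 : Integrable (gaussian D) := by
      refine (h.const_mul (1 / √(2 * Real.pi * D ^ 2))).congr (Eventually.of_forall fun q => ?_)
      simp only [gaussian]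
      congr 2
      ring
    exact h2.comp_sub_right s

/-- The distribution `φ_D(q - s) δ(p - p₀)` for `D ∈ [0, ∞]`, where `φ_0 = δ` and
`φ_∞ = 1/(2l)`. -/
def spreadDist (l : ℝ) (D : ℝ≥0∞) (s p₀ : ℝ) : Distribution l :=
  if D = 0 then deltaDist l s p₀
  else if D = ⊤ then constDist l (1 / (2 * l)) p₀
  else lineDist l (fun q => gaussian D.toReal (q - s)) (integrable_gaussian _ s) p₀

/-! ### Coherent states on the circle and their evolution -/

/-- The complex Hilbert space `L₂(-l, l)`. -/
abbrev L2 (l : ℝ) : Type := Lp ℂ 2 (volume.restrict (Set.Icc (-l) l))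

/-- The coherent state `η_{qp}` on the line. -/
def lineCoherent (hbar α q p x : ℝ) : ℂ :=
  ((1 / (2 * Real.pi * α ^ 2) ^ (1 / 4 : ℝ) : ℝ) : ℂ) *
    Complex.exp (((-(x - q) ^ 2 / (4 * α ^ 2) : ℝ) : ℂ) +
      Complex.I * ((p * (x - q) / hbar : ℝ) : ℂ))

/-- The coherent state `υ_{qp}(x) = ∑_n η_{qp}(x - 2nl)` on the circle, as a function. -/
def circleCoherentFun (l hbar α q p x : ℝ) : ℂ :=
  ∑' n : ℤ, lineCoherent hbar α q p (x - 2 * n * l)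

theorem summable_exp_neg_abs_int : Summable fun n : ℤ => Real.exp (-|(n : ℝ)|) := by
  refine Summable.of_nat_of_neg ?_ ?_ <;> simpa using Real.summable_exp_neg_nat

theorem memLp_circleCoherentFun (l hbar α q p : ℝ) :
    MemLp (circleCoherentFun l hbar α q p) 2 (volume.restrict (Set.Icc (-l) l)) := by
  rcases eq_or_ne α 0 with rfl | hα
  · have h : circleCoherentFun l hbar 0 q p = fun _ => 0 := by
      ext x; simp [circleCoherentFun, lineCoherent]
    rw [h]
    exact MemLp.zero
  rcases le_or_gt l 0 with hl | hl
  · have h : (volume.restrict (Set.Icc (-l) l) : Measure ℝ) = 0 := by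
      rw [Measure.restrict_eq_zero, Real.volume_Icc]
      exact ENNReal.ofReal_of_nonpos (by linarith)
    rw [h]
    exact memLp_measure_zero
  set c : ℝ := 1 / (2 * Real.pi * α ^ 2) ^ (1 / 4 : ℝ) with hc
  have hc0 : 0 ≤ c := by positivity
  set K : ℝ := (l + |q|) / (2 * l) + α ^ 2 / (4 * l ^ 2) with hK
  set u : ℤ → ℝ := fun n => c * Real.exp K * Real.exp (-|(n : ℝ)|) with hu
  have hus : Summable u := summable_exp_neg_abs_int.mul_left _
  have hb : ∀ (n : ℤ) (x : ℝ), x ∈ Set.Icc (-l) l →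
      ‖lineCoherent hbar α q p (x - 2 * n * l)‖ ≤ u n := by
    intro n x hx
    have e : ‖lineCoherent hbar α q p (x - 2 * n * l)‖ =
        c * Real.exp (-(x - 2 * n * l - q) ^ 2 / (4 * α ^ 2)) := by
      rw [lineCoherent, norm_mul, Complex.norm_exp, Complex.norm_real, Real.norm_of_nonneg hc0]
      congr 2
      simp [-Complex.ofReal_neg, -Complex.ofReal_mul, -Complex.ofReal_div, -Complex.ofReal_pow,
        -Complex.ofReal_sub]
    rw [e, hu]
    simp only
    rw [mul_assoc c, ← Real.exp_add]
    refine mul_le_mul_of_nonneg_left (Real.exp_le_exp.2 ?_) hc0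
    set z : ℝ := x - 2 * n * l - q with hz
    have h1 : 2 * l * |(n : ℝ)| ≤ l + |q| + |z| := by
      have : 2 * l * |(n : ℝ)| = |x - q - z| := by
        rw [show x - q - z = 2 * l * n by rw [hz]; ring, abs_mul,
          abs_of_pos (show (0 : ℝ) < 2 * l by linarith)]
      rw [this]
      have hx' : |x| ≤ l := abs_le.2 hx
      calc |x - q - z| ≤ |x - q| + |z| := abs_sub _ _
        _ ≤ |x| + |q| + |z| := by gcongr; exact abs_sub _ _
        _ ≤ _ := by linarith
    have h2 : |(n : ℝ)| ≤ (l + |q|) / (2 * l) + |z| / (2 * l) := by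
      rw [← add_div, le_div_iff₀ (by linarith)]; linarith
    have hα' : 0 < |α| := abs_pos.2 hα
    have h3 : |z| / (2 * l) ≤ z ^ 2 / (4 * α ^ 2) + α ^ 2 / (4 * l ^ 2) := by
      have h4 := sq_nonneg (|z| / (2 * |α|) - |α| / (2 * l))
      have h5 : (|z| / (2 * |α|) - |α| / (2 * l)) ^ 2 =
          z ^ 2 / (4 * α ^ 2) + α ^ 2 / (4 * l ^ 2) - |z| / (2 * l) := by
        rw [← sq_abs z, ← sq_abs α]; field_simp; ring
      linarith
    rw [neg_div]
    linarith
  have hcont : ContinuousOn (circleCoherentFun l hbar α q p) (Set.Icc (-l) l) := by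
    refine continuousOn_tsum (fun n => ?_) hus hb
    unfold lineCoherent
    fun_prop
  obtain ⟨C, hC⟩ := isCompact_Icc.exists_bound_of_continuousOn hcont
  exact MemLp.of_bound (hcont.aestronglyMeasurable measurableSet_Icc) C
    (ae_restrict_of_forall_mem measurableSet_Icc hC)

/-- The coherent state `υ_{qp}` on the circle, as a vector of `L₂(-l, l)`. -/
def circleCoherent (l hbar α q p : ℝ) : L2 l :=
  (memLp_circleCoherentFun l hbar α q p).toLp

/-- The function `e_k(x) = (2l)^(-1/2) exp(iπkx/l)`. -/
def basisFun (l : ℝ) (k : ℤ) (x : ℝ) : ℂ :=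
  ((1 / √(2 * l) : ℝ) : ℂ) * Complex.exp (Complex.I * ((Real.pi / l * k * x : ℝ) : ℂ))

theorem memLp_basisFun (l : ℝ) (k : ℤ) :
    MemLp (basisFun l k) 2 (volume.restrict (Set.Icc (-l) l)) := by
  refine MemLp.of_bound (C := 1 / √(2 * l)) ?_ (Eventually.of_forall fun x => le_of_eq ?_)
  · refine Continuous.aestronglyMeasurable ?_
    unfold basisFun
    fun_prop
  · rw [basisFun, norm_mul, mul_comm Complex.I, Complex.norm_exp_ofReal_mul_I, Complex.norm_real,
      Real.norm_of_nonneg (by positivity), mul_one]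

/-- The orthonormal basis vector `e_k` of `L₂(-l, l)`. -/
def basisVec (l : ℝ) (k : ℤ) : L2 l := (memLp_basisFun l k).toLp

/-- `ψ` lies in the domain of the Hamiltonian `H = -(ħ²/2m) d²/dx²` on the circle and `H ψ = χ`:
`ψ` has a representative `f` on `[-l, l]` with absolutely continuous derivative `f'` and
square-integrable second derivative `g`, it satisfies the periodic boundary conditions
`f(-l) = f(l)` and `f'(-l) = f'(l)`, and `χ = -(ħ²/2m) g`. -/
def IsHamiltonianValue (hbar m l : ℝ) (ψ χ : L2 l) : Prop :=
  ∃ f f' g : ℝ → ℂ,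
    ψ =ᵐ[volume.restrict (Set.Icc (-l) l)] f ∧
    χ =ᵐ[volume.restrict (Set.Icc (-l) l)] (fun x => -((hbar ^ 2 / (2 * m) : ℝ) : ℂ) * g x) ∧
    MemLp g 2 (volume.restrict (Set.Icc (-l) l)) ∧
    (∀ x ∈ Set.Icc (-l) l, f x = f (-l) + ∫ y in (-l)..x, f' y) ∧
    (∀ x ∈ Set.Icc (-l) l, f' x = f' (-l) + ∫ y in (-l)..x, g y) ∧
    f (-l) = f l ∧ f' (-l) = f' l

/-- The eigenvalue `(ħ²/2m) (πk/l)²` of the Hamiltonian. -/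
def energy (hbar m l : ℝ) (k : ℤ) : ℝ := hbar ^ 2 / (2 * m) * (Real.pi / l * k) ^ 2

theorem hasDerivAt_basisFun (l : ℝ) (k : ℤ) (x : ℝ) :
    HasDerivAt (basisFun l k) (Complex.I * ((Real.pi / l * k : ℝ) : ℂ) * basisFun l k x) x := by
  have h1 : HasDerivAt (fun y : ℝ => Complex.I * ((Real.pi / l * k * y : ℝ) : ℂ))
      (Complex.I * ((Real.pi / l * k : ℝ) : ℂ)) x := by
    have := ((hasDerivAt_id x).const_mul (Real.pi / l * k)).ofReal_comp.const_mul Complex.I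
    simpa using this
  have h2 := h1.cexp.const_mul (((1 / √(2 * l) : ℝ) : ℂ))
  refine h2.congr_deriv ?_
  simp only [basisFun]
  ring

/-- The vectors `e_k` are eigenvectors of the Hamiltonian. -/
theorem isHamiltonianValue_basisVec (hbar m : ℝ) {l : ℝ} (hl : 0 < l) (k : ℤ) :
    IsHamiltonianValue hbar m l (basisVec l k) ((energy hbar m l k : ℂ) • basisVec l k) := by
  set b : ℂ := Complex.I * ((Real.pi / l * k : ℝ) : ℂ) with hb
  have hcont : Continuous (basisFun l k) := by unfold basisFun; fun_prop
  have hper : basisFun l k (-l) = basisFun l k l := by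
    have : Complex.I * ((Real.pi / l * k * l : ℝ) : ℂ) =
        Complex.I * ((Real.pi / l * k * (-l) : ℝ) : ℂ) + k * (2 * Real.pi * Complex.I) := by
      have : (l : ℂ) ≠ 0 := by exact_mod_cast hl.ne'
      push_cast; field_simp; ring
    simp only [basisFun]
    rw [this, Complex.exp_add, Complex.exp_int_mul_two_pi_mul_I, mul_one]
  have hint : ∀ x, ∫ y in (-l)..x, b * basisFun l k y = basisFun l k x - basisFun l k (-l) :=
    fun x => intervalIntegral.integral_eq_sub_of_hasDerivAt
      (fun y _ => hasDerivAt_basisFun l k y) ((by fun_prop : Continuous _).intervalIntegrable _ _)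
  refine ⟨basisFun l k, fun x => b * basisFun l k x, fun x => b * (b * basisFun l k x),
    MemLp.coeFn_toLp _, ?_, ((memLp_basisFun l k).const_mul b).const_mul b, ?_, ?_, hper, ?_⟩
  · filter_upwards [Lp.coeFn_smul (energy hbar m l k : ℂ) (basisVec l k),
      MemLp.coeFn_toLp (memLp_basisFun l k)] with x h1 h2
    rw [h1, Pi.smul_apply, basisVec, h2, smul_eq_mul]
    have hbb : b * b = -(((Real.pi / l * k) ^ 2 : ℝ) : ℂ) := by
      rw [hb]; push_cast; linear_combination ((Real.pi / l * k : ℂ)) ^ 2 * Complex.I_mul_I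
    rw [← mul_assoc b b, hbb, energy]
    push_cast; ring
  · intro x _; rw [hint]; ring
  · intro x _
    rw [intervalIntegral.integral_const_mul, hint]; ring
  · simp only [hper]

/-- The evolution operator `U_t = exp(-itH/ħ)` on `L₂(-l, l)`. The `e_k` form an orthonormal basis
of eigenvectors of the self-adjoint operator `H`, so `U_t ψ = ∑_k exp(-i t E_k/ħ) (e_k, ψ) e_k`,
a series that converges in `L₂(-l, l)` for every `ψ`. -/
def evolution (hbar m l t : ℝ) (ψ : L2 l) : L2 l :=
  ∑' k : ℤ, (Complex.exp (-(Complex.I * ((t / hbar * energy hbar m l k : ℝ) : ℂ))) *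
    ⟪basisVec l k, ψ⟫_ℂ) • basisVec l k

/-- The transition density `(1/(2πħ)) |(υ_{qp}, υ_{q'p',t})|²` as a function of `x' = (q', p')`,
for fixed `x = (q, p)`. -/
def transitionDensity (hbar α m l t : ℝ) (x x' : ℝ × ℝ) : ℝ :=
  1 / (2 * Real.pi * hbar) *
    ‖⟪circleCoherent l hbar α x.1 x.2,
      evolution hbar m l t (circleCoherent l hbar α x'.1 x'.2)⟫_ℂ‖ ^ 2

/-- The strip `Ω = [-l, l] × ℝ`. -/
def strip (l : ℝ) : Set (ℝ × ℝ) := Set.Icc (-l) l ×ˢ Set.univ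

/-- The distribution `T` is the regular distribution on the cylinder with density `f`. -/
def HasDensity {l : ℝ} (T : Distribution l) (f : ℝ × ℝ → ℝ) : Prop :=
  ∀ σ : TestFun l, IntegrableOn (fun x => f x * σ x) (strip l) ∧
    T σ = ∫ x in strip l, f x * σ x

/-! ### The limit distributions -/

/-- The revival time `T_rev = 4ml²/(πħ)`. -/
def revivalTime (hbar m l : ℝ) : ℝ := 4 * m * l ^ 2 / (Real.pi * hbar)

/-- The number `N'` of packets: `N` for odd `N` and `N/2` for even `N`. -/
def numPackets (N : ℕ) : ℕ := if Even N then N / 2 else N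

/-- The shift `a`: `2l/N` if `N ≡ 2 (mod 4)` and `0` otherwise. -/
def packetShift (l : ℝ) (N : ℕ) : ℝ := if N % 4 = 2 then 2 * l / N else 0

/-- `(1/N') ∑_{k<N'} φ_D(q' - q - 2kl/N' - a + (p/m) s) δ(p' - p)`, a distribution in the
variables `(q', p')`; here `x = (q, p)` and `s` is the time elapsed since the revival. -/
def revivalDist (m l : ℝ) (N : ℕ) (D : ℝ≥0∞) (s : ℝ) (x : ℝ × ℝ) : Distribution l :=
  (1 / (numPackets N : ℝ)) • ∑ k ∈ Finset.range (numPackets N),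
    spreadDist l D (x.1 + 2 * k * l / numPackets N + packetShift l N - x.2 / m * s) x.2

end CircleCoherent

end

/-!
# Fractional revivals of coherent states on the circle

Write `κ_k = πk/l`. The Fourier coefficients of a coherent state on the circle are Gaussians in `k`
centred at `p/ħ` (`inner_basisVec_circleCoherent`), so the transition density is an absolutely
convergent double series over pairs of modes `(k + n, k)` (`hasSum_transitionDensity`). Integration
over `q'` against a test function `σ` turns the factor `exp (-iκ_n q')` into the `n`-th Fourier
coefficient `σ_n(p')`, and the pairing becomes a sum over `n` of sums over `k` (`hasSum_pairing`).

For fixed `n` the weights confine `p'` to a window of width `ħ/α` around `p`, so `σ_n(p')` may be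
replaced by `σ_n(p)` (`norm_pairingTerm_sub_le`). What remains is a Gaussian sum over `k` of width
`1/α` with phase `exp (-2πiρk)`, where `ρ = 2cn + (t - c T_rev) ħκ_n/(2ml) → 2cn`. Poisson
summation (`tsum_main_term`) turns it into a sum of narrow Gaussians `exp (-(π/a) (j + ρ)²)` with
`a → 0`; in the limit only a term with `j + 2cn = 0` can survive
(`tendsto_tsum_gaussian_sub_resonant`). Such a `j` exists exactly when `2cn` is an integer: for
`c = M/N` this means `N' ∣ n`, and for irrational `c` it means `n = 0`. The surviving term is
`exp (-2πicn²) exp (-iκ_n (p/m) (t - c T_rev)) exp (-D²κ_n²/2)` in the limit, whose last factor is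
the Fourier transform of `φ_D`; for `N' ∣ n` the factor `exp (-2πicn²)` is the phase of the
translation by `a` (`exp_packetShift`). Comparison of Fourier coefficients identifies the limit
(`hasSum_limitTerm_rational`, `hasSum_limitTerm_irrational`).

The contribution of each `n` is bounded by a multiple of `sup |σ_n|`, which is summable because `σ`
is smooth, so dominated convergence over `n` applies (`tendsto_pairing_sub_tsum_limitTerm`). No
bound depends on `(q, p)`: in the limit statements `(q, p)` is an arbitrary function of the index of
the filter, and this is what gives uniformity.
-/

open MeasureTheory Filter Topology
open scoped ENNReal ContDiff InnerProductSpace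

noncomputable section

namespace CircleCoherent

/-! ### Gaussian sums over the integers -/

theorem summable_exp_neg_mul_add_sq {c : ℝ} (hc : 0 < c) (v : ℝ) :
    Summable fun k : ℤ => Real.exp (-c * (k + v) ^ 2) := by
  have h := summable_pow_mul_jacobiTheta₂_term_bound (c * |v| / Real.pi)
    (div_pos hc Real.pi_pos) 0
  refine h.of_nonneg_of_le (fun k => (Real.exp_pos _).le) fun k => ?_
  rw [pow_zero, one_mul, Real.exp_le_exp]
  have h1 : -Real.pi * (c / Real.pi * (k : ℝ) ^ 2 - 2 * (c * |v| / Real.pi) * |(k : ℝ)|) =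
      -c * (k : ℝ) ^ 2 + 2 * c * (|v| * |(k : ℝ)|) := by
    field_simp [Real.pi_ne_zero]; ring
  push_cast
  rw [h1, ← abs_mul]
  nlinarith [neg_abs_le (v * k), mul_nonneg hc.le (sq_nonneg v),
    mul_le_mul_of_nonneg_left (neg_abs_le (v * k)) hc.le]

/-- Poisson summation for a shifted and modulated Gaussian on `ℤ`. -/
theorem tsum_gaussian_mul_character {a : ℝ} (ha : 0 < a) (v ρ : ℝ) :
    ∑' k : ℤ, ((Real.exp (-Real.pi * a * (k - v) ^ 2) : ℝ) : ℂ) *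
        Complex.exp (-(2 * Real.pi * ρ * k : ℝ) * Complex.I) =
      ((1 / √a : ℝ) : ℂ) * ∑' j : ℤ, ((Real.exp (-Real.pi / a * (j + ρ) ^ 2) : ℝ) : ℂ) *
        Complex.exp (-(2 * Real.pi * v * (j + ρ) : ℝ) * Complex.I) := by
  have hac : (a : ℂ) ≠ 0 := by exact_mod_cast ha.ne'
  have h := Complex.tsum_exp_neg_quadratic (a := (a : ℂ)) (by simpa using ha)
    ((a * v : ℝ) - ρ * Complex.I)
  have hs : (a : ℂ) ^ (1 / 2 : ℂ) = ((√a : ℝ) : ℂ) := by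
    rw [Real.sqrt_eq_rpow, Complex.ofReal_cpow ha.le]; norm_num
  rw [hs] at h
  have h1 : ∀ k : ℤ, ((Real.exp (-Real.pi * a * (k - v) ^ 2) : ℝ) : ℂ) *
      Complex.exp (-(2 * Real.pi * ρ * k : ℝ) * Complex.I) =
      Complex.exp (-Real.pi * a * v ^ 2) * Complex.exp (-Real.pi * a * k ^ 2 +
        2 * Real.pi * ((a * v : ℝ) - ρ * Complex.I) * k) := by
    intro k
    rw [Complex.ofReal_exp, ← Complex.exp_add, ← Complex.exp_add]
    congr 1
    push_cast
    ring
  have h2 : ∀ j : ℤ, ((Real.exp (-Real.pi / a * (j + ρ) ^ 2) : ℝ) : ℂ) *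
      Complex.exp (-(2 * Real.pi * v * (j + ρ) : ℝ) * Complex.I) =
      Complex.exp (-Real.pi * a * v ^ 2) * Complex.exp (-Real.pi / a *
        (j + Complex.I * ((a * v : ℝ) - ρ * Complex.I)) ^ 2) := by
    intro j
    rw [Complex.ofReal_exp, ← Complex.exp_add, ← Complex.exp_add]
    congr 1
    push_cast
    field_simp
    ring_nf
    simp only [Complex.I_sq, show Complex.I ^ 3 = -Complex.I by
      rw [pow_succ, Complex.I_sq]; ring, Complex.I_pow_four]
    ring
  simp_rw [h1, h2]
  rw [tsum_mul_left, tsum_mul_left, h]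
  push_cast
  ring

/-- The constant `∑ⱼ exp (-π j²)`. -/
def thetaConst : ℝ := ∑' j : ℤ, Real.exp (-Real.pi * (j : ℝ) ^ 2)

/-- The bound does not depend on the centre `v`: after Poisson summation `v` enters only through
phases. -/
theorem tsum_exp_neg_mul_sub_sq_le {a : ℝ} (ha : 0 < a) (ha1 : a ≤ 1) (v : ℝ) :
    ∑' k : ℤ, Real.exp (-Real.pi * a * (k - v) ^ 2) ≤ 1 / √a * thetaConst := by
  have h := tsum_gaussian_mul_character ha v 0
  simp only [mul_zero, zero_mul, Complex.ofReal_zero, neg_zero, Complex.exp_zero, mul_one,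
    add_zero] at h
  rw [← Complex.ofReal_tsum] at h
  have hpos : 0 ≤ ∑' k : ℤ, Real.exp (-Real.pi * a * (k - v) ^ 2) :=
    tsum_nonneg fun _ => (Real.exp_pos _).le
  have hsum : Summable fun j : ℤ => Real.exp (-Real.pi / a * (j : ℝ) ^ 2) := by
    simpa [neg_div] using summable_exp_neg_mul_add_sq (c := Real.pi / a) (by positivity) 0
  have hn : ∀ j : ℤ, ‖((Real.exp (-Real.pi / a * (j : ℝ) ^ 2) : ℝ) : ℂ) *
      Complex.exp (-(2 * Real.pi * v * j : ℝ) * Complex.I)‖ =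
      Real.exp (-Real.pi / a * (j : ℝ) ^ 2) := by
    intro j
    rw [norm_mul, ← Complex.ofReal_neg, Complex.norm_exp_ofReal_mul_I, mul_one, Complex.norm_real,
      Real.norm_of_nonneg (Real.exp_pos _).le]
  calc ∑' k : ℤ, Real.exp (-Real.pi * a * (k - v) ^ 2)
      = ‖((∑' k : ℤ, Real.exp (-Real.pi * a * (k - v) ^ 2) : ℝ) : ℂ)‖ := by
        rw [Complex.norm_real, Real.norm_of_nonneg hpos]
    _ ≤ 1 / √a * ∑' j : ℤ, Real.exp (-Real.pi / a * (j : ℝ) ^ 2) := by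
        rw [h, norm_mul, Complex.norm_real, Real.norm_of_nonneg (by positivity)]
        refine mul_le_mul_of_nonneg_left ?_ (by positivity)
        refine (norm_tsum_le_tsum_norm (by simpa only [hn] using hsum)).trans ?_
        simp only [hn, le_refl]
    _ ≤ 1 / √a * thetaConst := by
        refine mul_le_mul_of_nonneg_left ?_ (by positivity)
        refine hsum.tsum_le_tsum (fun j => ?_)
          (by simpa using summable_exp_neg_mul_add_sq Real.pi_pos 0)
        rw [Real.exp_le_exp, neg_div, neg_mul, neg_mul, neg_le_neg_iff]
        refine mul_le_mul_of_nonneg_right ?_ (sq_nonneg _)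
        rw [le_div_iff₀ ha]
        nlinarith [Real.pi_pos]

/-- As `a → 0` and `ρ → ρ₀`, all terms of the dual Gaussian sum vanish in the limit, uniformly,
except for the resonant one `j = -ρ₀`, which is present only if `ρ₀` is an integer. -/
theorem tendsto_tsum_gaussian_sub_resonant {ι : Type*} {G : Filter ι} {a ρ v : ι → ℝ} {ρ₀ : ℝ}
    (ha : ∀ i, 0 < a i) (ha0 : Tendsto a G (𝓝 0)) (hρ : Tendsto ρ G (𝓝 ρ₀)) :
    Tendsto (fun i => (∑' j : ℤ, ((Real.exp (-Real.pi / a i * (j + ρ i) ^ 2) : ℝ) : ℂ) *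
        Complex.exp (-(2 * Real.pi * v i * (j + ρ i) : ℝ) * Complex.I)) -
      ∑' j : ℤ, if (j : ℝ) + ρ₀ = 0 then
        ((Real.exp (-Real.pi / a i * (j + ρ i) ^ 2) : ℝ) : ℂ) *
        Complex.exp (-(2 * Real.pi * v i * (j + ρ i) : ℝ) * Complex.I) else 0) G (𝓝 0) := by
  set f : ι → ℤ → ℂ := fun i j => ((Real.exp (-Real.pi / a i * (j + ρ i) ^ 2) : ℝ) : ℂ) *
        Complex.exp (-(2 * Real.pi * v i * (j + ρ i) : ℝ) * Complex.I) with hf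
  have hn : ∀ i j, ‖f i j‖ = Real.exp (-Real.pi / a i * (j + ρ i) ^ 2) := by
    intro i j
    rw [hf]
    simp only
    rw [norm_mul, ← Complex.ofReal_neg, Complex.norm_exp_ofReal_mul_I, mul_one, Complex.norm_real,
      Real.norm_of_nonneg (Real.exp_pos _).le]
  have hsum : ∀ i, Summable (f i) := fun i => by
    refine Summable.of_norm ?_
    simp only [hn, neg_div]
    exact summable_exp_neg_mul_add_sq (div_pos Real.pi_pos (ha i)) _
  have hsum' : ∀ i, Summable fun j : ℤ => if (j : ℝ) + ρ₀ = 0 then f i j else 0 := fun i => by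
    refine Summable.of_norm ((hsum i).norm.of_nonneg_of_le (fun _ => norm_nonneg _) fun j => ?_)
    split_ifs <;> simp
  have key : Tendsto (fun i => ∑' j : ℤ, (f i j - if (j : ℝ) + ρ₀ = 0 then f i j else 0)) G
      (𝓝 (∑' _ : ℤ, (0 : ℂ))) := by
    refine tendsto_tsum_of_dominated_convergence
      (bound := fun j : ℤ => Real.exp Real.pi * Real.exp (-(Real.pi / 2) * (j + ρ₀) ^ 2))
      ((summable_exp_neg_mul_add_sq (by positivity) _).mul_left _) (fun j => ?_) ?_
    · by_cases hj : (j : ℝ) + ρ₀ = 0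
      · simpa [hj] using tendsto_const_nhds
      · simp only [hj, if_false, sub_zero]
        rw [tendsto_zero_iff_norm_tendsto_zero]
        simp only [hn]
        have h1 : Tendsto (fun i => ((j : ℝ) + ρ i) ^ 2) G (𝓝 (((j : ℝ) + ρ₀) ^ 2)) :=
          (hρ.const_add _).pow 2
        have h2 : Tendsto (fun i => (a i)⁻¹) G atTop :=
          tendsto_inv_nhdsGT_zero.comp
            (tendsto_nhdsWithin_iff.2 ⟨ha0, Eventually.of_forall ha⟩)
        have h3 := (h2.atTop_mul_pos (by positivity) h1).const_mul_atTop Real.pi_pos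
        refine (Real.tendsto_exp_neg_atTop_nhds_zero.comp h3).congr fun i => ?_
        simp only [Function.comp]
        congr 1
        ring
    · filter_upwards [ha0.eventually (gt_mem_nhds zero_lt_one),
        hρ.eventually (Metric.ball_mem_nhds ρ₀ zero_lt_one)] with i hi1 hi2 j
      have h1 : ‖f i j - if (j : ℝ) + ρ₀ = 0 then f i j else 0‖ ≤ ‖f i j‖ := by
        split_ifs <;> simp
      refine h1.trans ?_
      rw [hn, ← Real.exp_add, Real.exp_le_exp]
      have h2 : (ρ i - ρ₀) ^ 2 ≤ 1 := by
        rw [Real.dist_eq] at hi2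
        rw [sq_le_one_iff_abs_le_one]; exact hi2.le
      have h3 : Real.pi * ((j : ℝ) + ρ i) ^ 2 ≤ Real.pi / a i * (j + ρ i) ^ 2 := by
        refine mul_le_mul_of_nonneg_right ?_ (sq_nonneg _)
        rw [le_div_iff₀ (ha i)]
        nlinarith [Real.pi_pos]
      -- `(y + δ)² ≥ y² / 2 - δ²` with `|δ| ≤ 1` gives a majorant that does not depend on `i`
      have h4 : ((j : ℝ) + ρ₀) ^ 2 / 2 - 1 ≤ ((j : ℝ) + ρ i) ^ 2 := by
        nlinarith [sq_nonneg (((j : ℝ) + ρ₀) + 2 * (ρ i - ρ₀))]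
      have h5 := mul_le_mul_of_nonneg_left h4 Real.pi_pos.le
      rw [neg_div]
      linarith
  rw [tsum_zero] at key
  refine key.congr fun i => ?_
  exact (hsum i).tsum_sub (hsum' i)

/-! ### Periodization and Fourier coefficients of the coherent states -/

theorem hasSum_integral_comp_sub_period {E : Type*} [NormedAddCommGroup E] [NormedSpace ℝ E]
    {l : ℝ} (hl : 0 < l) {f : ℝ → E} (hf : Integrable f) :
    HasSum (fun n : ℤ => ∫ x in Set.Icc (-l) l, f (x - 2 * n * l)) (∫ x, f x) := by
  have hT : (0 : ℝ) < 2 * l := by positivity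
  have h := hasSum_integral_iUnion (μ := volume) (f := f)
    (fun n : ℤ => measurableSet_Ioc (a := -l + n • (2 * l)) (b := -l + (n + 1) • (2 * l)))
    (Set.pairwise_disjoint_Ioc_add_zsmul (-l) (2 * l)) hf.integrableOn
  rw [iUnion_Ioc_add_zsmul hT, setIntegral_univ] at h
  rw [← (Equiv.neg ℤ).hasSum_iff] at h
  convert h using 2 with n
  have h1 := intervalIntegral.integral_comp_sub_right (a := -l) (b := l) f (2 * n * l)
  rw [intervalIntegral.integral_of_le (by linarith), intervalIntegral.integral_of_le
    (by linarith)] at h1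
  rw [integral_Icc_eq_integral_Ioc, h1, Equiv.neg_apply]
  congr 3
  all_goals
    rw [zsmul_eq_mul]
    push_cast
    ring

/-- Integrating the periodization of `f` over one period gives the integral of `f`. -/
theorem integral_tsum_comp_sub_period {l : ℝ} (hl : 0 < l) {f : ℝ → ℂ} (hf : Integrable f) :
    ∫ x in Set.Icc (-l) l, ∑' n : ℤ, f (x - 2 * n * l) = ∫ x, f x := by
  have h := hasSum_integral_of_summable_integral_norm
    (μ := volume.restrict (Set.Icc (-l) l)) (F := fun (n : ℤ) x => f (x - 2 * n * l))
    (fun n => (hf.comp_sub_right (2 * n * l)).integrableOn)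
    (hasSum_integral_comp_sub_period hl hf.norm).summable
  exact h.unique (hasSum_integral_comp_sub_period hl hf)

/-- The wave number `πk/l` of the basis function `e_k`. -/
def freq (l : ℝ) (k : ℤ) : ℝ := Real.pi / l * k

/-- The Fourier transform of the coherent state on the line. -/
theorem integrable_lineCoherent_mul {hbar α : ℝ} (hα : 0 < α) (q p κ : ℝ) :
    Integrable (fun x => lineCoherent hbar α q p x * Complex.exp (-(κ * x : ℝ) * Complex.I)) ∧
    ∫ x, lineCoherent hbar α q p x * Complex.exp (-(κ * x : ℝ) * Complex.I) =
      ((1 / (2 * Real.pi * α ^ 2) ^ (1 / 4 : ℝ) * √(4 * Real.pi * α ^ 2) *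
        Real.exp (-α ^ 2 * (κ - p / hbar) ^ 2) : ℝ) : ℂ) *
        Complex.exp (-(κ * q : ℝ) * Complex.I) := by
  have hαc : (α : ℂ) ≠ 0 := by exact_mod_cast hα.ne'
  set b : ℂ := -((1 / (4 * α ^ 2) : ℝ) : ℂ) with hb
  set c : ℂ := (q / (2 * α ^ 2) : ℝ) + ((p / hbar - κ : ℝ) : ℂ) * Complex.I with hc
  set d : ℂ := (-q ^ 2 / (4 * α ^ 2) : ℝ) - ((p * q / hbar : ℝ) : ℂ) * Complex.I with hd
  have hb0 : b.re < 0 := by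
    rw [hb, Complex.neg_re, Complex.ofReal_re, neg_lt_zero]; positivity
  have e : (fun x => lineCoherent hbar α q p x * Complex.exp (-(κ * x : ℝ) * Complex.I)) =
      fun x : ℝ => ((1 / (2 * Real.pi * α ^ 2) ^ (1 / 4 : ℝ) : ℝ) : ℂ) *
        Complex.exp (b * x ^ 2 + c * x + d) := by
    ext x
    rw [lineCoherent, mul_assoc, ← Complex.exp_add, hb, hc, hd]
    congr 2
    push_cast
    ring
  rw [e]
  refine ⟨(integrable_cexp_quadratic' hb0 c d).const_mul _, ?_⟩
  rw [integral_const_mul, integral_cexp_quadratic hb0]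
  have hs : ((Real.pi : ℂ) / -b) ^ (1 / 2 : ℂ) = ((√(4 * Real.pi * α ^ 2) : ℝ) : ℂ) := by
    rw [Real.sqrt_eq_rpow, Complex.ofReal_cpow (by positivity), hb]
    congr 1
    · push_cast; field_simp
    · norm_num
  have hx : d - c ^ 2 / (4 * b) = ((-α ^ 2 * (κ - p / hbar) ^ 2 : ℝ) : ℂ) +
      -(κ * q : ℝ) * Complex.I := by
    have h4 : c ^ 2 / (4 * b) = -(α : ℂ) ^ 2 * c ^ 2 := by
      rw [hb]; push_cast; field_simp
    have h5 : (α : ℂ) ^ 2 * c ^ 2 = (q ^ 2 / (4 * α ^ 2) : ℝ) +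
        ((q * (p / hbar - κ) : ℝ) : ℂ) * Complex.I - (α ^ 2 * (p / hbar - κ) ^ 2 : ℝ) := by
      rw [hc]
      push_cast
      field_simp
      ring_nf
      simp only [Complex.I_sq]
      ring
    rw [h4, neg_mul, sub_neg_eq_add, h5, hd]
    push_cast
    ring
  rw [hs, hx, Complex.exp_add]
  push_cast
  ring

/-- The real Gaussian factor `exp (-α² (πk/l - v)²)` of the `k`-th Fourier coefficient of a coherent
state with mean wave number `v = p/ħ`. -/
def gaussWeight (l α v : ℝ) (k : ℤ) : ℝ := Real.exp (-α ^ 2 * (freq l k - v) ^ 2)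

theorem gaussWeight_pos (l α v : ℝ) (k : ℤ) : 0 < gaussWeight l α v k := Real.exp_pos _

theorem gaussWeight_le_one (l α v : ℝ) (k : ℤ) : gaussWeight l α v k ≤ 1 :=
  Real.exp_le_one_iff.2 (by nlinarith [mul_nonneg (sq_nonneg α) (sq_nonneg (freq l k - v))])

theorem summable_gaussWeight {l α : ℝ} (hl : 0 < l) (hα : 0 < α) (v : ℝ) :
    Summable (gaussWeight l α v) := by
  refine (summable_exp_neg_mul_add_sq (c := α ^ 2 * (Real.pi / l) ^ 2) (by positivity)
    (-(v * l / Real.pi))).congr fun k => ?_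
  rw [gaussWeight, freq]
  congr 1
  field_simp [Real.pi_ne_zero]
  ring

/-- The constant factor of the Fourier coefficients of the coherent states: `(2l)^(-1/2)` from `e_k`,
the normalization of `η_{qp}`, and the Gaussian integral `√(4πα²)`. -/
def coeffScale (l α : ℝ) : ℝ :=
  1 / √(2 * l) * (1 / (2 * Real.pi * α ^ 2) ^ (1 / 4 : ℝ) * √(4 * Real.pi * α ^ 2))

theorem coeffScale_pow_four {l α : ℝ} (hl : 0 < l) (hα : 0 < α) :
    coeffScale l α ^ 4 = 2 * Real.pi * α ^ 2 / l ^ 2 := by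
  have h1 : ((2 * Real.pi * α ^ 2) ^ (1 / 4 : ℝ)) ^ 4 = 2 * Real.pi * α ^ 2 := by
    rw [← Real.rpow_natCast, ← Real.rpow_mul (by positivity)]
    norm_num
  have h2 : √(4 * Real.pi * α ^ 2) ^ 4 = (4 * Real.pi * α ^ 2) ^ 2 := by
    rw [show 4 = 2 * 2 from rfl, pow_mul, Real.sq_sqrt (by positivity)]
  have h3 : √(2 * l) ^ 4 = (2 * l) ^ 2 := by
    rw [show 4 = 2 * 2 from rfl, pow_mul, Real.sq_sqrt (by positivity)]
  rw [coeffScale, mul_pow, mul_pow, div_pow, div_pow, h1, h2, h3]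
  field_simp
  ring

theorem inner_basisVec_circleCoherent {l hbar α : ℝ} (hl : 0 < l) (hα : 0 < α) (q p : ℝ) (k : ℤ) :
    ⟪basisVec l k, circleCoherent l hbar α q p⟫_ℂ =
      ((coeffScale l α * gaussWeight l α (p / hbar) k : ℝ) : ℂ) *
        Complex.exp (-(freq l k * q : ℝ) * Complex.I) := by
  obtain ⟨hint, hval⟩ := integrable_lineCoherent_mul (hbar := hbar) hα q p (freq l k)
  have hlc : (l : ℂ) ≠ 0 := by exact_mod_cast hl.ne'
  have h1 : ⟪basisVec l k, circleCoherent l hbar α q p⟫_ℂ =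
      ∫ x in Set.Icc (-l) l, ((1 / √(2 * l) : ℝ) : ℂ) * ∑' n : ℤ,
        (fun y => lineCoherent hbar α q p y * Complex.exp (-(freq l k * y : ℝ) * Complex.I))
          (x - 2 * n * l) := by
    rw [L2.inner_def]
    refine integral_congr_ae ?_
    filter_upwards [MemLp.coeFn_toLp (memLp_basisFun l k),
      MemLp.coeFn_toLp (memLp_circleCoherentFun l hbar α q p)] with x hx1 hx2
    rw [basisVec, circleCoherent, hx1, hx2, RCLike.inner_apply]
    have h2 : ∀ n : ℤ, Complex.exp (-(freq l k * (x - 2 * n * l) : ℝ) * Complex.I) =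
        Complex.exp (-(freq l k * x : ℝ) * Complex.I) := by
      intro n
      have : (-(freq l k * (x - 2 * n * l) : ℝ) * Complex.I : ℂ) =
          -(freq l k * x : ℝ) * Complex.I + ((k * n : ℤ) : ℂ) * (2 * Real.pi * Complex.I) := by
        rw [freq]; push_cast; field_simp; ring
      rw [this, Complex.exp_add, Complex.exp_int_mul_two_pi_mul_I, mul_one]
    simp only [h2]
    rw [tsum_mul_right, circleCoherentFun, basisFun, map_mul, Complex.conj_ofReal,
      ← Complex.exp_conj, map_mul, Complex.conj_I, Complex.conj_ofReal, ← freq]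
    rw [show -Complex.I * ((freq l k * x : ℝ) : ℂ) = -(freq l k * x : ℝ) * Complex.I by ring]
    ring
  rw [h1, integral_const_mul, integral_tsum_comp_sub_period hl hint, hval, coeffScale, gaussWeight]
  push_cast
  ring

/-! ### The overlap and its squared modulus -/

/-- The phase of the `k`-th term of the overlap `(υ_{qp}, υ_{q'p',t})`. -/
def overlapPhase (hbar m l t q q' : ℝ) (k : ℤ) : ℝ :=
  freq l k * (q - q') - t / hbar * energy hbar m l k

/-- The coefficients of the evolved state are absolutely summable and the vectors `e_k` are bounded,
so its series converges absolutely in `L₂(-l, l)` and may be paired term by term. -/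
theorem hasSum_overlap {l hbar α : ℝ} (hl : 0 < l) (hα : 0 < α) (m t : ℝ) (x x' : ℝ × ℝ) :
    HasSum (fun k : ℤ => ((coeffScale l α ^ 2 * (gaussWeight l α (x.2 / hbar) k *
        gaussWeight l α (x'.2 / hbar) k) : ℝ) : ℂ) *
        Complex.exp (overlapPhase hbar m l t x.1 x'.1 k * Complex.I))
      ⟪circleCoherent l hbar α x.1 x.2,
        evolution hbar m l t (circleCoherent l hbar α x'.1 x'.2)⟫_ℂ := by
  have hnorm : ∃ C : ℝ, ∀ k, ‖basisVec l k‖ ≤ C := by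
    refine ⟨_, fun k => Lp.norm_le_of_ae_bound (C := 1 / √(2 * l)) (by positivity) ?_⟩
    filter_upwards [MemLp.coeFn_toLp (memLp_basisFun l k)] with y hy
    rw [basisVec, hy, basisFun, norm_mul, mul_comm Complex.I, Complex.norm_exp_ofReal_mul_I,
      Complex.norm_real, Real.norm_of_nonneg (by positivity), mul_one]
  obtain ⟨C, hC⟩ := hnorm
  have hs : Summable fun k : ℤ =>
      (Complex.exp (-(Complex.I * ((t / hbar * energy hbar m l k : ℝ) : ℂ))) *
        ⟪basisVec l k, circleCoherent l hbar α x'.1 x'.2⟫_ℂ) • basisVec l k := by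
    refine Summable.of_norm_bounded
      (g := fun k => |coeffScale l α| * gaussWeight l α (x'.2 / hbar) k * C)
      (((summable_gaussWeight hl hα _).mul_left _).mul_right _) fun k => ?_
    rw [norm_smul, inner_basisVec_circleCoherent hl hα, norm_mul, norm_mul, ← mul_neg,
      mul_comm Complex.I, ← Complex.ofReal_neg, ← Complex.ofReal_neg,
      Complex.norm_exp_ofReal_mul_I, Complex.norm_exp_ofReal_mul_I,
      Complex.norm_real, one_mul, mul_one, Real.norm_eq_abs, abs_mul,
      abs_of_pos (gaussWeight_pos _ _ _ _)]
    exact mul_le_mul_of_nonneg_left (hC k)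
      (mul_nonneg (abs_nonneg _) (gaussWeight_pos _ _ _ _).le)
  have h := hs.hasSum.mapL (innerSL ℂ (circleCoherent l hbar α x.1 x.2))
  simp only [innerSL_apply_apply] at h
  refine h.congr_fun fun k => ?_
  rw [inner_smul_right, ← inner_conj_symm _ (basisVec l k), inner_basisVec_circleCoherent hl hα,
    inner_basisVec_circleCoherent hl hα, map_mul, Complex.conj_ofReal, ← Complex.exp_conj, map_mul,
    map_neg, Complex.conj_I, Complex.conj_ofReal]
  have e : ((overlapPhase hbar m l t x.1 x'.1 k : ℝ) : ℂ) * Complex.I =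
      -(Complex.I * ((t / hbar * energy hbar m l k : ℝ) : ℂ)) +
        -(freq l k * x'.1 : ℝ) * Complex.I + -(freq l k * x.1 : ℝ) * -Complex.I := by
    rw [overlapPhase]; push_cast; ring
  rw [e, Complex.exp_add, Complex.exp_add]
  push_cast
  ring

/-- The product of the Gaussian factors with indices `k + n` and `k`, for `z = (n, k)`. -/
def pairWeight (l α v : ℝ) (z : ℤ × ℤ) : ℝ := gaussWeight l α v (z.2 + z.1) * gaussWeight l α v z.2

theorem pairWeight_nonneg (l α v : ℝ) (z : ℤ × ℤ) : 0 ≤ pairWeight l α v z :=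
  mul_nonneg (gaussWeight_pos _ _ _ _).le (gaussWeight_pos _ _ _ _).le

/-- The reparametrization `(n, k) ↦ (k + n, k)` of pairs of integers by their difference. -/
def diffEquiv : ℤ × ℤ ≃ ℤ × ℤ where
  toFun z := (z.2 + z.1, z.2)
  invFun w := (w.1 - w.2, w.2)
  left_inv z := by simp
  right_inv w := by simp

theorem summable_pairWeight {l α : ℝ} (hl : 0 < l) (hα : 0 < α) (v : ℝ) :
    Summable (pairWeight l α v) := by
  have h := (summable_gaussWeight hl hα v).mul_of_nonneg (summable_gaussWeight hl hα v)
    (fun _ => (gaussWeight_pos _ _ _ _).le) (fun _ => (gaussWeight_pos _ _ _ _).le)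
  exact (diffEquiv.summable_iff (f := fun w : ℤ × ℤ =>
    gaussWeight l α v w.1 * gaussWeight l α v w.2)).2 h

/-- The relative phase `(tħ/2m) (κ_{k+n}² - κ_k²)` acquired by the modes `k + n` and `k`, for
`z = (n, k)`. -/
def pairPhase (hbar m l t : ℝ) (z : ℤ × ℤ) : ℝ :=
  t * hbar / (2 * m) * (freq l z.1 * (2 * freq l z.2 + freq l z.1))

/-- The transition density as an absolutely convergent double series over `z = (n, k)`, where `n` is
the frequency in the variable `q'`. -/
theorem hasSum_transitionDensity {l hbar α : ℝ} (hl : 0 < l) (hh : 0 < hbar) (hα : 0 < α)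
    (m t : ℝ) (x x' : ℝ × ℝ) :
    HasSum (fun z : ℤ × ℤ => ((α ^ 2 / (hbar * l ^ 2) *
        (pairWeight l α (x.2 / hbar) z * pairWeight l α (x'.2 / hbar) z) : ℝ) : ℂ) *
        (Complex.exp (freq l z.1 * x.1 * Complex.I) *
          Complex.exp (-(pairPhase hbar m l t z) * Complex.I) *
          Complex.exp (-(freq l z.1 * x'.1) * Complex.I)))
      (transitionDensity hbar α m l t x x' : ℂ) := by
  set a : ℤ → ℂ := fun k : ℤ => ((coeffScale l α ^ 2 * (gaussWeight l α (x.2 / hbar) k *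
        gaussWeight l α (x'.2 / hbar) k) : ℝ) : ℂ) *
        Complex.exp (overlapPhase hbar m l t x.1 x'.1 k * Complex.I) with ha
  have hsum := hasSum_overlap hl hα m t x x' (hbar := hbar)
  rw [← ha] at hsum
  set S := ⟪circleCoherent l hbar α x.1 x.2,
        evolution hbar m l t (circleCoherent l hbar α x'.1 x'.2)⟫_ℂ with hS
  have hna : Summable fun k => ‖a k‖ := by
    refine ((summable_gaussWeight hl hα (x.2 / hbar)).mul_left (coeffScale l α ^ 2)).of_nonneg_of_le
      (fun _ => norm_nonneg _) fun k => ?_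
    rw [ha]
    simp only
    rw [norm_mul, Complex.norm_exp_ofReal_mul_I, mul_one, Complex.norm_real, Real.norm_eq_abs,
      abs_mul, abs_mul, abs_of_nonneg (sq_nonneg _), abs_of_pos (gaussWeight_pos _ _ _ _),
      abs_of_pos (gaussWeight_pos _ _ _ _)]
    refine mul_le_mul_of_nonneg_left ?_ (sq_nonneg _)
    exact mul_le_of_le_one_right (gaussWeight_pos _ _ _ _).le (gaussWeight_le_one _ _ _ _)
  have hnb : Summable fun k => ‖(starRingEnd ℂ) (a k)‖ := by simpa using hna
  have hprod := tsum_mul_tsum_of_summable_norm hna hnb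
  have hps := (summable_mul_of_summable_norm hna hnb).hasSum
  rw [← hprod, hsum.tsum_eq, (Complex.hasSum_conj'.2 hsum).tsum_eq, Complex.mul_conj,
    Complex.normSq_eq_norm_sq, ← diffEquiv.hasSum_iff] at hps
  have hfin := hps.mul_left (((1 / (2 * Real.pi * hbar) : ℝ)) : ℂ)
  rw [← Complex.ofReal_mul] at hfin
  refine hfin.congr_fun fun z => ?_
  obtain ⟨n, k⟩ := z
  have hscale : (coeffScale l α : ℂ) ^ 4 = 2 * Real.pi * α ^ 2 / l ^ 2 := by
    exact_mod_cast congrArg (fun r : ℝ => (r : ℂ)) (coeffScale_pow_four hl hα)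
  have hexp : Complex.exp (overlapPhase hbar m l t x.1 x'.1 (k + n) * Complex.I) *
      Complex.exp (-(overlapPhase hbar m l t x.1 x'.1 k) * Complex.I) =
      Complex.exp (freq l n * x.1 * Complex.I) *
          Complex.exp (-(pairPhase hbar m l t (n, k)) * Complex.I) *
          Complex.exp (-(freq l n * x'.1) * Complex.I) := by
    rw [← Complex.exp_add, ← Complex.exp_add, ← Complex.exp_add]
    congr 1
    have hhc : (hbar : ℂ) ≠ 0 := by exact_mod_cast hh.ne'
    simp only [overlapPhase, pairPhase, energy, freq]
    push_cast
    field_simp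
    ring
  simp only [Function.comp, diffEquiv, Equiv.coe_fn_mk, ha, pairWeight]
  rw [← hexp, map_mul, Complex.conj_ofReal, ← Complex.exp_conj, map_mul, Complex.conj_ofReal,
    Complex.conj_I]
  rw [show ((overlapPhase hbar m l t x.1 x'.1 k : ℝ) : ℂ) * -Complex.I =
    -(overlapPhase hbar m l t x.1 x'.1 k) * Complex.I by ring]
  have hpi : (Real.pi : ℂ) ≠ 0 := by exact_mod_cast Real.pi_ne_zero
  have hK : ((α : ℂ) ^ 2 / (hbar * l ^ 2)) = 1 / (2 * Real.pi * hbar) * (coeffScale l α : ℂ) ^ 4 := by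
    rw [hscale]; field_simp
  push_cast
  rw [hK]
  ring

/-! ### Pairing the transition density with a test function -/

theorem integrable_of_hasSum_of_summable_integral_norm {X ι E : Type*} [MeasurableSpace X]
    {μ : Measure X} [Countable ι] [NormedAddCommGroup E] {F : ι → X → E} {S : X → E}
    (hF : ∀ i, Integrable (F i) μ) (hsum : Summable fun i => ∫ a, ‖F i a‖ ∂μ)
    (hS : ∀ a, HasSum (fun i => F i a) (S a)) : Integrable S μ := by
  refine ⟨aestronglyMeasurable_of_tendsto_ae atTop (f := fun s : Finset ι => fun a => ∑ i ∈ s, F i a)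
    (fun s => s.aestronglyMeasurable_fun_sum fun i _ => (hF i).1) (Eventually.of_forall hS), ?_⟩
  have h1 : ∀ i, ∫⁻ a, ‖F i a‖ₑ ∂μ = ENNReal.ofReal (∫ a, ‖F i a‖ ∂μ) := fun i =>
    (ofReal_integral_norm_eq_lintegral_enorm (hF i)).symm
  calc ∫⁻ a, ‖S a‖ₑ ∂μ ≤ ∫⁻ a, ∑' i, ‖F i a‖ₑ ∂μ := by
        refine lintegral_mono fun a => ?_
        rw [← (hS a).tsum_eq]
        exact enorm_tsum_le_tsum_enorm
    _ = ∑' i, ENNReal.ofReal (∫ a, ‖F i a‖ ∂μ) := by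
        rw [lintegral_tsum fun i => (hF i).1.enorm]
        simp only [h1]
    _ < ⊤ := hsum.tsum_ofReal_lt_top

/-- Completing the square: the product of the two Gaussians is centred at the mean wave number
`κ_k + κ_n/2`. -/
theorem pairWeight_eq (l α v : ℝ) (z : ℤ × ℤ) :
    pairWeight l α v z = Real.exp (-(α * freq l z.1) ^ 2 / 2) *
      Real.exp (-(2 * α ^ 2) * (freq l z.2 + freq l z.1 / 2 - v) ^ 2) := by
  rw [pairWeight, gaussWeight, gaussWeight, ← Real.exp_add, ← Real.exp_add]
  congr 1
  simp only [freq]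
  push_cast
  ring

/-- A Gaussian in the wave number `p/ħ`, integrated over the momentum `p`. -/
theorem gaussian_momentum {hbar b : ℝ} (hh : 0 < hbar) (hb : 0 < b) (u : ℝ) :
    Integrable (fun p : ℝ => Real.exp (-b * (u - p / hbar) ^ 2)) ∧
    ∫ p : ℝ, Real.exp (-b * (u - p / hbar) ^ 2) = hbar * √(Real.pi / b) := by
  have e : ∀ p : ℝ, Real.exp (-b * (u - p / hbar) ^ 2) =
      Real.exp (-(b / hbar ^ 2) * (p - hbar * u) ^ 2) := by
    intro p
    congr 1
    field_simp
    ring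
  simp only [e]
  refine ⟨(integrable_exp_neg_mul_sq (b := b / hbar ^ 2) (by positivity)).comp_sub_right
    (hbar * u), ?_⟩
  rw [integral_sub_right_eq_self (fun p : ℝ => Real.exp (-(b / hbar ^ 2) * p ^ 2)),
    integral_gaussian, show Real.pi / (b / hbar ^ 2) = hbar ^ 2 * (Real.pi / b) by field_simp,
    Real.sqrt_mul (by positivity), Real.sqrt_sq hh.le]

theorem integrable_pairWeight {l hbar α : ℝ} (hh : 0 < hbar) (hα : 0 < α) (z : ℤ × ℤ) :
    Integrable (fun p : ℝ => pairWeight l α (p / hbar) z) := by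
  simp only [pairWeight_eq]
  exact (gaussian_momentum hh (b := 2 * α ^ 2) (by positivity) _).1.const_mul _

theorem integral_pairWeight {l hbar α : ℝ} (hh : 0 < hbar) (hα : 0 < α) (z : ℤ × ℤ) :
    ∫ p : ℝ, pairWeight l α (p / hbar) z =
      Real.exp (-(α * freq l z.1) ^ 2 / 2) * (hbar / α * √(Real.pi / 2)) := by
  simp only [pairWeight_eq]
  rw [integral_const_mul, (gaussian_momentum hh (b := 2 * α ^ 2) (by positivity) _).2,
    show Real.pi / (2 * α ^ 2) = (Real.pi / 2) / α ^ 2 by field_simp,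
    Real.sqrt_div (by positivity), Real.sqrt_sq hα.le]
  ring

theorem integral_pairWeight_le {l hbar α : ℝ} (hh : 0 < hbar) (hα : 0 < α) (z : ℤ × ℤ) :
    ∫ p : ℝ, pairWeight l α (p / hbar) z ≤ hbar / α * √(Real.pi / 2) := by
  rw [integral_pairWeight hh hα]
  refine mul_le_of_le_one_left (by positivity) (Real.exp_le_one_iff.2 ?_)
  nlinarith [sq_nonneg (α * freq l z.1)]

theorem volume_restrict_strip (l : ℝ) :
    (volume.restrict (strip l) : Measure (ℝ × ℝ)) =
      (volume.restrict (Set.Icc (-l) l)).prod volume := by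
  rw [strip, Measure.volume_eq_prod, ← Measure.prod_restrict, Measure.restrict_univ]

/-- The term with index `z = (n, k)` of the double series for the transition density at `x'`. -/
def densityTerm (hbar α m l t : ℝ) (x : ℝ × ℝ) (z : ℤ × ℤ) (x' : ℝ × ℝ) : ℂ :=
  ((α ^ 2 / (hbar * l ^ 2) *
    (pairWeight l α (x.2 / hbar) z * pairWeight l α (x'.2 / hbar) z) : ℝ) : ℂ) *
    (Complex.exp (freq l z.1 * x.1 * Complex.I) *
      Complex.exp (-(pairPhase hbar m l t z) * Complex.I) *
      Complex.exp (-(freq l z.1 * x'.1) * Complex.I))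

theorem norm_densityTerm {hbar : ℝ} (hh : 0 < hbar) (α m l t : ℝ) (x : ℝ × ℝ) (z : ℤ × ℤ)
    (x' : ℝ × ℝ) : ‖densityTerm hbar α m l t x z x'‖ = α ^ 2 / (hbar * l ^ 2) *
      (pairWeight l α (x.2 / hbar) z * pairWeight l α (x'.2 / hbar) z) := by
  have h := mul_nonneg (a := α ^ 2 / (hbar * l ^ 2)) (by positivity)
    (mul_nonneg (pairWeight_nonneg l α (x.2 / hbar) z) (pairWeight_nonneg l α (x'.2 / hbar) z))
  rw [densityTerm, norm_mul, norm_mul, norm_mul]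
  norm_cast
  simp only [Complex.norm_exp_ofReal_mul_I, mul_one]
  rw [Real.norm_of_nonneg h]

theorem continuous_densityTerm (hbar α m l t : ℝ) (x : ℝ × ℝ) (z : ℤ × ℤ) :
    Continuous (densityTerm hbar α m l t x z) := by
  unfold densityTerm pairWeight gaussWeight
  fun_prop

/-- The `n`-th Fourier coefficient of `σ(·, p)` on the circle. -/
def fourierSlice {l : ℝ} (σ : TestFun l) (n : ℤ) (p : ℝ) : ℂ :=
  ((1 / (2 * l) : ℝ) : ℂ) * ∫ q in (-l)..l, Complex.exp (-(freq l n * q) * Complex.I) * σ (q, p)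

/-- The factor of the mode pair `z = (n, k)` in the pairing with a test function: the momentum
average of its `n`-th Fourier coefficient against the Gaussian weight. -/
def momentumAverage {l : ℝ} (σ : TestFun l) (hbar α : ℝ) (z : ℤ × ℤ) : ℂ :=
  ∫ p : ℝ, (pairWeight l α (p / hbar) z : ℂ) * fourierSlice σ z.1 p

section pairing

variable {l hbar α : ℝ} (hl : 0 < l) (hh : 0 < hbar) (hα : 0 < α) (m t : ℝ) (x : ℝ × ℝ)
include hl hh hα

theorem integrable_densityTerm_mul {g : ℝ × ℝ → ℂ} (hg : Continuous g) {C : ℝ}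
    (hC : ∀ x, ‖g x‖ ≤ C) (z : ℤ × ℤ) :
    IntegrableOn (fun x' => densityTerm hbar α m l t x z x' * g x') (strip l) ∧
    ∫ x' in strip l, ‖densityTerm hbar α m l t x z x' * g x'‖ ≤
      α ^ 2 / (hbar * l ^ 2) * (hbar / α * √(Real.pi / 2)) * (2 * l) * C *
        pairWeight l α (x.2 / hbar) z := by
  have hC0 : 0 ≤ C := (norm_nonneg _).trans (hC 0)
  have hw0 := pairWeight_nonneg l α (x.2 / hbar) z
  have hw := integrable_pairWeight (l := l) hh hα z
  have hprod : Integrable (fun x' : ℝ × ℝ => (1 : ℝ) * pairWeight l α (x'.2 / hbar) z)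
      ((volume.restrict (Set.Icc (-l) l)).prod volume) :=
    (integrable_const (1 : ℝ)).mul_prod hw
  have hdom := hprod.const_mul (α ^ 2 / (hbar * l ^ 2) * pairWeight l α (x.2 / hbar) z * C)
  have hle : ∀ x', ‖densityTerm hbar α m l t x z x' * g x'‖ ≤
      α ^ 2 / (hbar * l ^ 2) * pairWeight l α (x.2 / hbar) z * C *
        (1 * pairWeight l α (x'.2 / hbar) z) := by
    intro x'
    rw [norm_mul, norm_densityTerm hh]
    have h1 := pairWeight_nonneg l α (x'.2 / hbar) z
    calc _ ≤ α ^ 2 / (hbar * l ^ 2) *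
          (pairWeight l α (x.2 / hbar) z * pairWeight l α (x'.2 / hbar) z) * C :=
          mul_le_mul_of_nonneg_left (hC x') (by positivity)
      _ = _ := by ring
  have hint : IntegrableOn (fun x' => densityTerm hbar α m l t x z x' * g x') (strip l) := by
    rw [IntegrableOn, volume_restrict_strip]
    exact hdom.mono' ((continuous_densityTerm hbar α m l t x z).mul hg).aestronglyMeasurable
      (Eventually.of_forall hle)
  refine ⟨hint, ?_⟩
  calc _ ≤ ∫ x' in strip l, α ^ 2 / (hbar * l ^ 2) * pairWeight l α (x.2 / hbar) z * C *
        (1 * pairWeight l α (x'.2 / hbar) z) := by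
        refine integral_mono hint.norm ?_ hle
        rw [volume_restrict_strip]; exact hdom
    _ = α ^ 2 / (hbar * l ^ 2) * pairWeight l α (x.2 / hbar) z * C *
        ((2 * l) * ∫ p, pairWeight l α (p / hbar) z) := by
        rw [volume_restrict_strip, integral_const_mul,
          integral_prod_mul (fun _ : ℝ => (1 : ℝ)) (fun p => pairWeight l α (p / hbar) z)]
        congr 2
        simp [Real.volume_real_Icc_of_le (show -l ≤ l by linarith)]
        ring
    _ ≤ α ^ 2 / (hbar * l ^ 2) * pairWeight l α (x.2 / hbar) z * C *
        ((2 * l) * (hbar / α * √(Real.pi / 2))) := by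
        gcongr
        exact integral_pairWeight_le hh hα z
    _ = _ := by ring

theorem hasSum_integral_densityTerm_mul {g : ℝ × ℝ → ℂ} (hg : Continuous g) {C : ℝ}
    (hC : ∀ x, ‖g x‖ ≤ C) :
    IntegrableOn (fun x' => (transitionDensity hbar α m l t x x' : ℂ) * g x') (strip l) ∧
    HasSum (fun z => ∫ x' in strip l, densityTerm hbar α m l t x z x' * g x')
      (∫ x' in strip l, (transitionDensity hbar α m l t x x' : ℂ) * g x') := by
  have h1 := fun z => (integrable_densityTerm_mul hl hh hα m t x hg hC z).1
  have h2 : Summable fun z => ∫ x' in strip l, ‖densityTerm hbar α m l t x z x' * g x'‖ :=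
    ((summable_pairWeight hl hα (x.2 / hbar)).mul_left _).of_nonneg_of_le
      (fun _ => integral_nonneg fun _ => norm_nonneg _)
      fun z => (integrable_densityTerm_mul hl hh hα m t x hg hC z).2
  have h3 : ∀ x', HasSum (fun z => densityTerm hbar α m l t x z x' * g x')
      ((transitionDensity hbar α m l t x x' : ℂ) * g x') := fun x' =>
    (hasSum_transitionDensity hl hh hα m t x x').mul_right _
  refine ⟨integrable_of_hasSum_of_summable_integral_norm h1 h2 h3, ?_⟩
  have h4 := hasSum_integral_of_summable_integral_norm h1 h2
  simpa only [fun x' => (h3 x').tsum_eq] using h4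

theorem integrableOn_transitionDensity :
    IntegrableOn (transitionDensity hbar α m l t x) (strip l) := by
  have h := (hasSum_integral_densityTerm_mul hl hh hα m t x
    (g := fun _ => 1) continuous_const (C := 1) (by simp)).1
  simpa [IntegrableOn] using h.re

/-- The transition density is integrable on the strip and so defines a distribution. -/
theorem exists_distribution_transitionDensity :
    ∃ T : Distribution l, HasDensity T (transitionDensity hbar α m l t x) := by
  have hint := integrableOn_transitionDensity hl hh hα m t x
  have hσ : ∀ σ : TestFun l,
      IntegrableOn (fun x' => transitionDensity hbar α m l t x x' * σ x') (strip l) := fun σ =>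
    hint.mul_bdd (c := testSeminorm l 0 σ) σ.continuous.aestronglyMeasurable
      (Eventually.of_forall fun x' => σ.abs_le x')
  refine ⟨mkDistribution
    { toFun := fun σ => ∫ x' in strip l, transitionDensity hbar α m l t x x' * σ x'
      map_add' := fun σ τ => by
        rw [← integral_add (hσ σ) (hσ τ)]
        exact integral_congr_ae (Eventually.of_forall fun x' => mul_add _ _ _)
      map_smul' := fun c σ => by
        rw [RingHom.id_apply, smul_eq_mul, ← integral_const_mul]
        exact integral_congr_ae (Eventually.of_forall fun x' => mul_left_comm _ _ _) }
    (∫ x' in strip l, |transitionDensity hbar α m l t x x'|) fun σ => ?_,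
    fun σ => ⟨hσ σ, rfl⟩⟩
  refine abs_integral_le_integral_abs.trans ?_
  rw [← integral_mul_const]
  refine integral_mono (hσ σ).abs (hint.abs.mul_const _) fun x' => ?_
  simp only [abs_mul]
  exact mul_le_mul_of_nonneg_left (σ.abs_le _) (abs_nonneg _)

/-- The pairing of the transition density with a test function as a double series over the mode
pairs `z = (n, k)`. -/
theorem hasSum_pairing (σ : TestFun l) :
    HasSum (fun z : ℤ × ℤ => ((2 * α ^ 2 / (hbar * l) * pairWeight l α (x.2 / hbar) z : ℝ) : ℂ) *
        (Complex.exp (freq l z.1 * x.1 * Complex.I) *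
          Complex.exp (-(pairPhase hbar m l t z) * Complex.I)) * momentumAverage σ hbar α z)
      ((∫ x' in strip l, transitionDensity hbar α m l t x x' * σ x' : ℝ) : ℂ) := by
  have hg : Continuous fun x' => (σ x' : ℂ) := Complex.continuous_ofReal.comp σ.continuous
  have hC : ∀ x', ‖(σ x' : ℂ)‖ ≤ testSeminorm l 0 σ := fun x' => by
    rw [Complex.norm_real]; exact σ.abs_le x'
  have h := (hasSum_integral_densityTerm_mul hl hh hα m t x hg hC).2
  have e : ((∫ x' in strip l, transitionDensity hbar α m l t x x' * σ x' : ℝ) : ℂ) =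
      ∫ x' in strip l, (transitionDensity hbar α m l t x x' : ℂ) * σ x' := by
    rw [← integral_complex_ofReal]
    simp only [Complex.ofReal_mul]
  rw [e]
  refine h.congr_fun fun z => ?_
  have hint := (integrable_densityTerm_mul hl hh hα m t x hg hC z).1
  rw [IntegrableOn, volume_restrict_strip] at hint
  rw [volume_restrict_strip, integral_prod_symm _ hint, momentumAverage, ← integral_const_mul]
  refine integral_congr_ae (Eventually.of_forall fun p => ?_)
  simp only [densityTerm, fourierSlice]
  rw [intervalIntegral.integral_of_le (by linarith), ← integral_Icc_eq_integral_Ioc,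
    ← integral_const_mul, ← integral_const_mul, ← integral_const_mul]
  refine integral_congr_ae (Eventually.of_forall fun q => ?_)
  have hlc : (l : ℂ) ≠ 0 := by exact_mod_cast hl.ne'
  have hhc : (hbar : ℂ) ≠ 0 := by exact_mod_cast hh.ne'
  simp only
  push_cast
  field_simp

end pairing

/-! ### Fourier series of test functions -/

section fourierSlice

variable {l : ℝ} (σ : TestFun l)

theorem TestFun.exists_abs_mixedPartial_le (s₁ s₂ : ℕ) :
    ∃ C : ℝ, 0 ≤ C ∧ ∀ x, |mixedPartial s₁ s₂ σ x| ≤ C := by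
  obtain ⟨C, hC⟩ := σ.2.2.2 0 s₁ s₂
  have h : ∀ x, |mixedPartial s₁ s₂ σ x| ≤ C := fun x => by simpa [weight] using hC x
  exact ⟨C, (abs_nonneg _).trans (h 0), h⟩

theorem contDiff_partialQ {f : ℝ × ℝ → ℝ} (hf : ContDiff ℝ ∞ f) : ContDiff ℝ ∞ (partialQ f) :=
  contDiff_fderiv_apply hf (1, 0)

theorem hasDerivAt_partialQ {f : ℝ × ℝ → ℝ} (hf : ContDiff ℝ ∞ f) (q p : ℝ) :
    HasDerivAt (fun q => f (q, p)) (partialQ f (q, p)) q :=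
  ((hf.differentiable (by simp) (q, p)).hasFDerivAt).comp_hasDerivAt q
    ((hasDerivAt_id q).prodMk (hasDerivAt_const q p))

theorem hasDerivAt_partialP {f : ℝ × ℝ → ℝ} (hf : ContDiff ℝ ∞ f) (q p : ℝ) :
    HasDerivAt (fun p => f (q, p)) (partialP f (q, p)) p :=
  ((hf.differentiable (by simp) (q, p)).hasFDerivAt).comp_hasDerivAt p
    ((hasDerivAt_const p q).prodMk (hasDerivAt_id p))

theorem partialQ_add_period (q p : ℝ) : partialQ σ (q + 2 * l, p) = partialQ σ (q, p) := by
  have h : (fun x : ℝ × ℝ => σ (x + (2 * l, 0))) = σ := by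
    ext ⟨q, p⟩
    simpa using σ.2.1 1 q p
  have h2 := fderiv_comp_add_right (𝕜 := ℝ) (f := σ.1) (x := (q, p)) (2 * l, 0)
  rw [h] at h2
  rw [partialQ, partialQ, h2]
  simp

theorem exp_freq_mul_period (hl : 0 < l) (n : ℤ) (q : ℝ) :
    Complex.exp (-(freq l n * (q + 2 * l : ℝ)) * Complex.I) =
      Complex.exp (-(freq l n * q) * Complex.I) := by
  have hlc : (l : ℂ) ≠ 0 := by exact_mod_cast hl.ne'
  have : (-(freq l n * (q + 2 * l : ℝ)) * Complex.I : ℂ) =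
      -(freq l n * q) * Complex.I + ((-n : ℤ) : ℂ) * (2 * Real.pi * Complex.I) := by
    rw [freq]; push_cast; field_simp; ring
  rw [this, Complex.exp_add, Complex.exp_int_mul_two_pi_mul_I, mul_one]

theorem norm_fourierIntegral_le (hl : 0 < l) {f : ℝ → ℝ} {C : ℝ} (hC : ∀ q, |f q| ≤ C) (n : ℤ) :
    ‖((1 / (2 * l) : ℝ) : ℂ) * ∫ q in (-l)..l, Complex.exp (-(freq l n * q) * Complex.I) * f q‖ ≤
      C := by
  have h : ‖∫ q in (-l)..l, Complex.exp (-(freq l n * q) * Complex.I) * f q‖ ≤ C * |l - -l| := by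
    refine intervalIntegral.norm_integral_le_of_norm_le_const fun q _ => ?_
    rw [norm_mul]
    norm_cast
    rw [Complex.norm_exp_ofReal_mul_I, one_mul]
    exact hC q
  rw [norm_mul, Complex.norm_real, Real.norm_of_nonneg (by positivity)]
  calc _ ≤ 1 / (2 * l) * (C * |l - -l|) := mul_le_mul_of_nonneg_left h (by positivity)
    _ = C := by
      rw [abs_of_pos (by linarith)]; field_simp; ring

theorem freq_ne_zero (hl : 0 < l) {n : ℤ} (hn : n ≠ 0) : freq l n ≠ 0 := by
  have : (n : ℝ) ≠ 0 := by exact_mod_cast hn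
  rw [freq]; positivity

/-- Integrating by parts twice. -/
theorem fourierSlice_eq (hl : 0 < l) {n : ℤ} (hn : n ≠ 0) (p : ℝ) :
    fourierSlice σ n p = -(1 / (freq l n : ℂ) ^ 2) * (((1 / (2 * l) : ℝ) : ℂ) *
      ∫ q in (-l)..l, Complex.exp (-(freq l n * q) * Complex.I) *
        (mixedPartial 2 0 σ (q, p) : ℝ)) := by
  set κ : ℂ := (freq l n : ℂ) with hκ
  have hκ0 : κ ≠ 0 := by
    rw [hκ]
    exact_mod_cast freq_ne_zero hl hn
  have hσ1 := contDiff_partialQ σ.2.2.1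
  have hσ2 := contDiff_partialQ hσ1
  have hmp : mixedPartial 2 0 σ = partialQ (partialQ σ) := rfl
  have hc0 : Continuous fun q : ℝ => Complex.exp (-(κ * q) * Complex.I) * (σ (q, p) : ℂ) := by
    have := σ.continuous
    fun_prop
  have hc2 : Continuous fun q : ℝ => Complex.exp (-(κ * q) * Complex.I) *
      (partialQ (partialQ σ) (q, p) : ℂ) := by
    have := hσ2.continuous
    fun_prop
  -- the primitive of `exp(-iκq) (f + f''/κ²)` is periodic
  have hd : ∀ q : ℝ, HasDerivAt (fun q : ℝ => Complex.exp (-(κ * q) * Complex.I) *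
      (Complex.I / κ * (σ (q, p) : ℂ) + 1 / κ ^ 2 * (partialQ σ (q, p) : ℂ)))
      (Complex.exp (-(κ * q) * Complex.I) * (σ (q, p) : ℂ) +
        1 / κ ^ 2 * (Complex.exp (-(κ * q) * Complex.I) *
        (partialQ (partialQ σ) (q, p) : ℂ))) q := by
    intro q
    have h1 : HasDerivAt (fun q : ℝ => -(κ * q) * Complex.I) (-κ * Complex.I) q := by
      have := ((hasDerivAt_id q).ofReal_comp.const_mul κ).neg.mul_const Complex.I
      simpa using this
    have h2 := (hasDerivAt_partialQ σ.2.2.1 q p).ofReal_comp.const_mul (Complex.I / κ)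
    have h3 := (hasDerivAt_partialQ hσ1 q p).ofReal_comp.const_mul (1 / κ ^ 2)
    refine (h1.cexp.mul (h2.add h3)).congr_deriv ?_
    simp only [Pi.add_apply]
    field_simp
    ring_nf
    simp only [Complex.I_sq]
    ring
  have hi := intervalIntegral.integral_eq_sub_of_hasDerivAt (a := -l) (b := l)
    (fun q _ => hd q) ((hc0.add (hc2.const_mul _)).intervalIntegrable _ _)
  have hper : (-l) + 2 * l = l := by ring
  have e1 := exp_freq_mul_period hl n (-l)
  have e2 := partialQ_add_period σ (-l) p
  have e3 : σ (-l + 2 * l, p) = σ (-l, p) := by simpa using σ.2.1 1 (-l) p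
  rw [hper] at e1 e2 e3
  rw [e1, e2, e3, sub_self, intervalIntegral.integral_add (hc0.intervalIntegrable _ _)
    ((hc2.const_mul _).intervalIntegrable _ _), intervalIntegral.integral_const_mul] at hi
  rw [fourierSlice, hmp, ← hκ, eq_neg_of_add_eq_zero_left hi]
  ring

/-- The Fourier coefficients of a test function are summable, uniformly in the momentum. -/
theorem exists_summable_fourierSlice_bound (hl : 0 < l) :
    ∃ b : ℤ → ℝ, Summable b ∧ ∀ n p, ‖fourierSlice σ n p‖ ≤ b n := by
  obtain ⟨C₀, hC₀, h0⟩ := σ.exists_abs_mixedPartial_le 0 0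
  obtain ⟨C₂, hC₂, h2⟩ := σ.exists_abs_mixedPartial_le 2 0
  refine ⟨fun n => C₂ * l ^ 2 / Real.pi ^ 2 * (1 / (n : ℝ) ^ 2) + if n = 0 then C₀ else 0,
    ((Real.summable_one_div_int_pow.2 one_lt_two).mul_left _).add (hasSum_ite_eq 0 C₀).summable,
    fun n p => ?_⟩
  rcases eq_or_ne n 0 with rfl | hn
  · have h : ‖fourierSlice σ 0 p‖ ≤ C₀ := norm_fourierIntegral_le hl (fun q => h0 (q, p)) 0
    simpa using h
  · have h := norm_fourierIntegral_le hl (fun q => h2 (q, p)) n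
    rw [fourierSlice_eq σ hl hn, norm_mul]
    simp only [hn, if_false, add_zero]
    have e : ‖-(1 / (freq l n : ℂ) ^ 2)‖ = l ^ 2 / Real.pi ^ 2 * (1 / (n : ℝ) ^ 2) := by
      rw [norm_neg, norm_div, norm_pow, Complex.norm_real, norm_one, Real.norm_eq_abs, sq_abs, freq]
      field_simp
    rw [e]
    calc _ ≤ l ^ 2 / Real.pi ^ 2 * (1 / (n : ℝ) ^ 2) * C₂ :=
          mul_le_mul_of_nonneg_left h (by positivity)
      _ = _ := by ring

/-- The Fourier coefficients are Lipschitz in the momentum because `∂σ/∂p` is bounded. -/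
theorem exists_fourierSlice_lipschitz (hl : 0 < l) :
    ∃ L : ℝ, 0 ≤ L ∧ ∀ n p p', ‖fourierSlice σ n p' - fourierSlice σ n p‖ ≤ L * |p' - p| := by
  obtain ⟨L, hL, h⟩ := σ.exists_abs_mixedPartial_le 0 1
  refine ⟨L, hL, fun n p p' => ?_⟩
  have hlip : ∀ q, |σ (q, p') - σ (q, p)| ≤ L * |p' - p| := fun q => by
    have := convex_univ.norm_image_sub_le_of_norm_hasDerivWithin_le (𝕜 := ℝ)
      (f := fun p => σ (q, p)) (f' := fun p => partialP σ (q, p)) (C := L)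
      (fun y _ => (hasDerivAt_partialP σ.2.2.1 q y).hasDerivWithinAt)
      (fun y _ => h (q, y)) (Set.mem_univ p) (Set.mem_univ p')
    simpa using this
  have hc : ∀ r : ℝ, Continuous fun q : ℝ =>
      Complex.exp (-(freq l n * q) * Complex.I) * (σ (q, r) : ℂ) := fun r => by
    have := σ.continuous
    fun_prop
  have e : fourierSlice σ n p' - fourierSlice σ n p = ((1 / (2 * l) : ℝ) : ℂ) *
      ∫ q in (-l)..l, Complex.exp (-(freq l n * q) * Complex.I) *
        ((σ (q, p') - σ (q, p) : ℝ) : ℂ) := by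
    rw [fourierSlice, fourierSlice, ← mul_sub, ← intervalIntegral.integral_sub
      ((hc p').intervalIntegrable _ _) ((hc p).intervalIntegrable _ _)]
    congr 2
    ext q
    push_cast
    ring
  rw [e]
  exact norm_fourierIntegral_le hl hlip n

theorem hasSum_fourierSlice (hl : 0 < l) (q p : ℝ) :
    HasSum (fun n => fourierSlice σ n p * Complex.exp (freq l n * q * Complex.I)) (σ (q, p)) := by
  have : Fact (0 < 2 * l) := ⟨by positivity⟩
  have hlc : (l : ℂ) ≠ 0 := by exact_mod_cast hl.ne'
  have hper : Function.Periodic (fun q : ℝ => (σ (q, p) : ℂ)) (2 * l) := fun q => by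
    simpa using σ.2.1 1 q p
  have hcont : Continuous fun q : ℝ => (σ (q, p) : ℂ) := by
    have := σ.continuous
    fun_prop
  let f : C(AddCircle (2 * l), ℂ) := ⟨hper.lift, continuous_coinduced_dom.2 hcont⟩
  have hf : ∀ q : ℝ, f (q : AddCircle (2 * l)) = σ (q, p) := fun q => rfl
  have hfour : ∀ (n : ℤ) (q : ℝ), fourier n (q : AddCircle (2 * l)) =
      Complex.exp (freq l n * q * Complex.I) := by
    intro n q
    rw [fourier_coe_apply]
    congr 1
    rw [freq]
    push_cast
    field_simp
  have hcoef : ∀ n, fourierCoeff f n = fourierSlice σ n p := by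
    intro n
    rw [fourierCoeff_eq_intervalIntegral f n (-l), show -l + 2 * l = l by ring, fourierSlice,
      Complex.real_smul]
    congr 2
    ext q
    rw [hfour, hf, smul_eq_mul, freq, freq]
    congr 2
    push_cast
    ring
  obtain ⟨b, hb, hbn⟩ := exists_summable_fourierSlice_bound σ hl
  have hsum : Summable (fourierCoeff f) :=
    Summable.of_norm_bounded hb fun n => by rw [hcoef]; exact hbn n p
  have h := has_pointwise_sum_fourier_series_of_summable hsum (q : AddCircle (2 * l))
  simpa only [hcoef, hfour, hf, smul_eq_mul] using h

/-- The factor by which the `n`-th Fourier coefficient is damped by the convolution with `φ_D`. -/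
def spreadFactor (l : ℝ) (D : ℝ≥0∞) (n : ℤ) : ℝ :=
  if n = 0 then 1 else if D = ⊤ then 0 else Real.exp (-(D.toReal * freq l n) ^ 2 / 2)

theorem spreadFactor_nonneg (l : ℝ) (D : ℝ≥0∞) (n : ℤ) : 0 ≤ spreadFactor l D n := by
  unfold spreadFactor; split_ifs <;> positivity

theorem spreadFactor_le_one (l : ℝ) (D : ℝ≥0∞) (n : ℤ) : spreadFactor l D n ≤ 1 := by
  unfold spreadFactor
  split_ifs
  · exact le_rfl
  · exact zero_le_one
  · exact Real.exp_le_one_iff.2 (by nlinarith [sq_nonneg (D.toReal * freq l n)])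

theorem integral_gaussian_mul_character {D : ℝ} (hD : 0 < D) (s κ : ℝ) :
    ∫ q : ℝ, (gaussian D (q - s) : ℂ) * Complex.exp (κ * q * Complex.I) =
      Complex.exp (κ * s * Complex.I) * (Real.exp (-(D * κ) ^ 2 / 2) : ℝ) := by
  have hDc : (D : ℂ) ≠ 0 := by exact_mod_cast hD.ne'
  have h := fourierIntegral_gaussian (b := ((1 / (2 * D ^ 2) : ℝ) : ℂ))
    (by rw [Complex.ofReal_re]; positivity) κ
  have hs : ((Real.pi : ℂ) / ((1 / (2 * D ^ 2) : ℝ) : ℂ)) ^ (1 / 2 : ℂ) =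
      ((√(2 * Real.pi * D ^ 2) : ℝ) : ℂ) := by
    rw [Real.sqrt_eq_rpow, Complex.ofReal_cpow (by positivity)]
    congr 1
    · push_cast; field_simp
    · norm_num
  have hs0 : ((√(2 * Real.pi * D ^ 2) : ℝ) : ℂ) ≠ 0 := by
    exact_mod_cast (Real.sqrt_pos.2 (by positivity)).ne'
  rw [hs] at h
  rw [← integral_add_right_eq_self (fun q : ℝ => (gaussian D (q - s) : ℂ) *
    Complex.exp (κ * q * Complex.I)) s]
  have e : ∀ q : ℝ, (gaussian D (q + s - s) : ℂ) * Complex.exp (κ * (q + s : ℝ) * Complex.I) =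
      Complex.exp (κ * s * Complex.I) * (1 / ((√(2 * Real.pi * D ^ 2) : ℝ) : ℂ)) *
      (Complex.exp (Complex.I * κ * q) *
        Complex.exp (-((1 / (2 * D ^ 2) : ℝ) : ℂ) * (q : ℂ) ^ 2)) := by
    intro q
    rw [gaussian, add_sub_cancel_right, Complex.ofReal_mul, Complex.ofReal_exp]
    have e1 : Complex.exp (κ * (q + s : ℝ) * Complex.I) =
        Complex.exp (κ * s * Complex.I) * Complex.exp (Complex.I * κ * q) := by
      rw [← Complex.exp_add]; congr 1; push_cast; ring
    have e2 : ((-q ^ 2 / (2 * D ^ 2) : ℝ) : ℂ) = -((1 / (2 * D ^ 2) : ℝ) : ℂ) * (q : ℂ) ^ 2 := by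
      push_cast; ring
    rw [e1, e2]
    push_cast
    ring
  simp only [e]
  rw [integral_const_mul, h]
  have e3 : (-(κ : ℂ) ^ 2 / (4 * ((1 / (2 * D ^ 2) : ℝ) : ℂ))) =
      ((-(D * κ) ^ 2 / 2 : ℝ) : ℂ) := by
    push_cast; field_simp; ring
  rw [e3, Complex.ofReal_exp]
  field_simp

/-- The Fourier expansion of `φ_D(q' - s) δ(p' - p)`. -/
theorem hasSum_spreadDist (hl : 0 < l) (D : ℝ≥0∞) (s p : ℝ) :
    HasSum (fun n => fourierSlice σ n p * Complex.exp (freq l n * s * Complex.I) *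
      spreadFactor l D n) (spreadDist l D s p σ : ℂ) := by
  rcases eq_or_ne D 0 with rfl | hD0
  · have h : spreadDist l 0 s p σ = σ (s, p) := by simp [spreadDist]; rfl
    rw [h]
    refine (hasSum_fourierSlice σ hl s p).congr_fun fun n => ?_
    simp [spreadFactor]
  rcases eq_or_ne D ⊤ with rfl | hDt
  · have h : spreadDist l ⊤ s p σ = 1 / (2 * l) * ∫ q in (-l)..l, σ (q, p) := by
      simp [spreadDist]; rfl
    have h0 : fourierSlice σ 0 p = (spreadDist l ⊤ s p σ : ℂ) := by
      rw [h, Complex.ofReal_mul, ← intervalIntegral.integral_ofReal, fourierSlice]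
      simp [freq]
    refine (hasSum_ite_eq (0 : ℤ) ((spreadDist l ⊤ s p σ : ℝ) : ℂ)).congr_fun fun n => ?_
    rcases eq_or_ne n 0 with rfl | hn
    · simp [spreadFactor, h0, freq]
    · simp [spreadFactor, hn]
  · have hD : 0 < D.toReal := ENNReal.toReal_pos hD0 hDt
    have h : spreadDist l D s p σ = ∫ q, gaussian D.toReal (q - s) * σ (q, p) := by
      simp [spreadDist, hD0, hDt]; rfl
    have hg := integrable_gaussian D.toReal s
    have hint : ∀ n, Integrable fun q : ℝ => (gaussian D.toReal (q - s) : ℂ) *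
        (fourierSlice σ n p * Complex.exp (freq l n * q * Complex.I)) := fun n => by
      refine hg.ofReal.mul_bdd (c := ‖fourierSlice σ n p‖) (by fun_prop)
        (Eventually.of_forall fun q => ?_)
      rw [norm_mul]
      norm_cast
      rw [Complex.norm_exp_ofReal_mul_I, mul_one]
    obtain ⟨b, hb, hbn⟩ := exists_summable_fourierSlice_bound σ hl
    have hsum : Summable fun n => ∫ q : ℝ, ‖(gaussian D.toReal (q - s) : ℂ) *
        (fourierSlice σ n p * Complex.exp (freq l n * q * Complex.I))‖ := by
      have e : ∀ n, ∫ q : ℝ, ‖(gaussian D.toReal (q - s) : ℂ) *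
          (fourierSlice σ n p * Complex.exp (freq l n * q * Complex.I))‖ =
          (∫ q, |gaussian D.toReal (q - s)|) * ‖fourierSlice σ n p‖ := fun n => by
        rw [← integral_mul_const]
        refine integral_congr_ae (Eventually.of_forall fun q => ?_)
        simp only [norm_mul, Complex.norm_real, Real.norm_eq_abs]
        norm_cast
        rw [Complex.norm_exp_ofReal_mul_I, mul_one]
      simp only [e]
      exact (hb.of_nonneg_of_le (fun _ => norm_nonneg _) fun n => hbn n p).mul_left _
    have hs := hasSum_integral_of_summable_integral_norm hint hsum
    have e : ∫ q : ℝ, ∑' n, (gaussian D.toReal (q - s) : ℂ) *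
        (fourierSlice σ n p * Complex.exp (freq l n * q * Complex.I)) =
        (spreadDist l D s p σ : ℂ) := by
      rw [h, ← integral_complex_ofReal]
      refine integral_congr_ae (Eventually.of_forall fun q => ?_)
      simp only
      rw [tsum_mul_left, (hasSum_fourierSlice σ hl q p).tsum_eq, Complex.ofReal_mul]
    rw [e] at hs
    refine hs.congr_fun fun n => ?_
    have e2 : ∫ q : ℝ, (gaussian D.toReal (q - s) : ℂ) *
        (fourierSlice σ n p * Complex.exp (freq l n * q * Complex.I)) =
        fourierSlice σ n p * ∫ q : ℝ, (gaussian D.toReal (q - s) : ℂ) *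
          Complex.exp (freq l n * q * Complex.I) := by
      rw [← integral_const_mul]
      refine integral_congr_ae (Eventually.of_forall fun q => ?_)
      simp only
      ring
    rw [e2, integral_gaussian_mul_character hD]
    rcases eq_or_ne n 0 with rfl | hn
    · simp [spreadFactor, freq]
    · simp only [spreadFactor, hn, hDt, if_false]
      ring

end fourierSlice

/-! ### The contribution of one Fourier mode of the test function -/

theorem gaussian_freq_eq {l : ℝ} (hl : 0 < l) (b v : ℝ) (n k : ℤ) :
    Real.exp (-b * (freq l k + freq l n / 2 - v) ^ 2) =
      Real.exp (-Real.pi * (b * Real.pi / l ^ 2) * (k - (v * l / Real.pi - n / 2)) ^ 2) := by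
  congr 1
  rw [freq, freq]
  field_simp [Real.pi_ne_zero]
  ring

theorem summable_gaussian_freq {l b : ℝ} (hl : 0 < l) (hb : 0 < b) (v : ℝ) (n : ℤ) :
    Summable fun k : ℤ => Real.exp (-b * (freq l k + freq l n / 2 - v) ^ 2) := by
  simp only [gaussian_freq_eq hl]
  have h := summable_exp_neg_mul_add_sq (c := Real.pi * (b * Real.pi / l ^ 2)) (by positivity)
    (-(v * l / Real.pi - n / 2))
  simpa only [neg_mul, sub_eq_add_neg] using h

/-- The hypothesis `hb1` says that the Gaussian is at least as wide as the spacing of the wave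
numbers, up to a constant. -/
theorem tsum_gaussian_freq_le {l b : ℝ} (hl : 0 < l) (hb : 0 < b) (hb1 : b * Real.pi / l ^ 2 ≤ 1)
    (v : ℝ) (n : ℤ) :
    ∑' k : ℤ, Real.exp (-b * (freq l k + freq l n / 2 - v) ^ 2) ≤
      1 / √(b * Real.pi / l ^ 2) * thetaConst := by
  simp only [gaussian_freq_eq hl]
  exact tsum_exp_neg_mul_sub_sq_le (by positivity) hb1 _

theorem pairWeight_le {l α : ℝ} (v : ℝ) (z : ℤ × ℤ) :
    pairWeight l α v z ≤ Real.exp (-(2 * α ^ 2) * (freq l z.2 + freq l z.1 / 2 - v) ^ 2) := by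
  rw [pairWeight_eq]
  refine mul_le_of_le_one_left (Real.exp_pos _).le (Real.exp_le_one_iff.2 ?_)
  nlinarith [sq_nonneg (α * freq l z.1)]

theorem abs_mul_exp_neg_le (y : ℝ) : |y| * Real.exp (-2 * y ^ 2) ≤ Real.exp (-y ^ 2) := by
  have h1 : |y| ≤ Real.exp (y ^ 2) := by
    have h2 := Real.add_one_le_exp (y ^ 2)
    nlinarith [sq_nonneg (|y| - 1), sq_abs y, abs_nonneg y]
  calc |y| * Real.exp (-2 * y ^ 2) ≤ Real.exp (y ^ 2) * Real.exp (-2 * y ^ 2) :=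
        mul_le_mul_of_nonneg_right h1 (Real.exp_pos _).le
    _ = Real.exp (-y ^ 2) := by rw [← Real.exp_add]; congr 1; ring

open Classical in
/-- The phase of the `n`-th mode that survives at the fractional revival time `c T_rev`: the mode is
resonant when `2cn` is an integer, and averages out otherwise. -/
def resonance (c : ℝ) (n : ℤ) : ℂ :=
  if ∃ j : ℤ, (j : ℝ) = 2 * c * n then Complex.exp (-(2 * Real.pi * c * n ^ 2) * Complex.I) else 0

theorem norm_resonance_le (c : ℝ) (n : ℤ) : ‖resonance c n‖ ≤ 1 := by
  rw [resonance]
  split_ifs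
  · norm_cast
    rw [Complex.norm_exp_ofReal_mul_I]
  · simp

/-- The term with index `z = (n, k)` in the pairing of the transition density with `σ`. -/
def pairingTerm {l : ℝ} (σ : TestFun l) (hbar α m t : ℝ) (x : ℝ × ℝ) (z : ℤ × ℤ) : ℂ :=
  ((2 * α ^ 2 / (hbar * l) * pairWeight l α (x.2 / hbar) z : ℝ) : ℂ) *
    (Complex.exp (freq l z.1 * x.1 * Complex.I) *
      Complex.exp (-(pairPhase hbar m l t z) * Complex.I)) * momentumAverage σ hbar α z

section mode

variable {l hbar α : ℝ} (hl : 0 < l) (hh : 0 < hbar) (hα : 0 < α) (m t : ℝ) (x : ℝ × ℝ)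
  (σ : TestFun l)

theorem norm_pairing_phases (z : ℤ × ℤ) :
    ‖Complex.exp (freq l z.1 * x.1 * Complex.I) *
      Complex.exp (-(pairPhase hbar m l t z) * Complex.I)‖ = 1 := by
  rw [norm_mul]
  norm_cast
  rw [Complex.norm_exp_ofReal_mul_I, Complex.norm_exp_ofReal_mul_I, one_mul]

include hl in
theorem continuous_fourierSlice (n : ℤ) : Continuous (fourierSlice σ n) := by
  obtain ⟨L, hL, h⟩ := exists_fourierSlice_lipschitz σ hl
  refine (LipschitzWith.of_dist_le_mul (K := ⟨L, hL⟩) fun p p' => ?_).continuous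
  rw [dist_eq_norm, Real.dist_eq]
  exact h n p' p

include hh hα in
theorem norm_momentumAverage_le {b : ℝ} (z : ℤ × ℤ) (hb : ∀ p, ‖fourierSlice σ z.1 p‖ ≤ b) :
    ‖momentumAverage σ hbar α z‖ ≤ hbar / α * √(Real.pi / 2) * b := by
  have hb0 : 0 ≤ b := (norm_nonneg _).trans (hb 0)
  calc ‖momentumAverage σ hbar α z‖ ≤ ∫ p, pairWeight l α (p / hbar) z * b := by
        refine norm_integral_le_of_norm_le ((integrable_pairWeight hh hα z).mul_const b)
          (Eventually.of_forall fun p => ?_)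
        rw [norm_mul, Complex.norm_real, Real.norm_of_nonneg (pairWeight_nonneg _ _ _ _)]
        exact mul_le_mul_of_nonneg_left (hb p) (pairWeight_nonneg _ _ _ _)
    _ ≤ _ := by
        rw [integral_mul_const]
        exact mul_le_mul_of_nonneg_right (integral_pairWeight_le hh hα z) hb0

include hl hh hα

/-- Each Fourier mode of the test function contributes at most a multiple of its size. -/
theorem norm_tsum_pairingTerm_le (hα1 : 2 * α ^ 2 * Real.pi / l ^ 2 ≤ 1) {n : ℤ} {b : ℝ}
    (hb : ∀ p, ‖fourierSlice σ n p‖ ≤ b) :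
    ‖∑' k : ℤ, pairingTerm σ hbar α m t x (n, k)‖ ≤ thetaConst * b := by
  have hb0 : 0 ≤ b := (norm_nonneg _).trans (hb 0)
  have hle : ∀ k : ℤ, ‖pairingTerm σ hbar α m t x (n, k)‖ ≤ 2 * α / l * √(Real.pi / 2) * b *
      Real.exp (-(2 * α ^ 2) * (freq l k + freq l n / 2 - x.2 / hbar) ^ 2) := by
    intro k
    rw [pairingTerm, norm_mul, norm_mul, norm_pairing_phases, mul_one, Complex.norm_real,
      Real.norm_of_nonneg (mul_nonneg (by positivity) (pairWeight_nonneg _ _ _ _))]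
    calc _ ≤ 2 * α ^ 2 / (hbar * l) *
          Real.exp (-(2 * α ^ 2) * (freq l k + freq l n / 2 - x.2 / hbar) ^ 2) *
          (hbar / α * √(Real.pi / 2) * b) := by
          refine mul_le_mul (mul_le_mul_of_nonneg_left (pairWeight_le _ _) (by positivity))
            (norm_momentumAverage_le hh hα σ (n, k) hb) (norm_nonneg _) (by positivity)
      _ = _ := by field_simp
  have hs := summable_gaussian_freq hl (b := 2 * α ^ 2) (by positivity) (x.2 / hbar) n
  refine (tsum_of_norm_bounded (hs.mul_left _).hasSum hle).trans ?_
  rw [tsum_mul_left]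
  have h1 := tsum_gaussian_freq_le hl (b := 2 * α ^ 2) (by positivity) hα1 (x.2 / hbar) n
  have h2 : √(2 * α ^ 2 * Real.pi / l ^ 2) = 2 * α / l * √(Real.pi / 2) := by
    rw [show 2 * α ^ 2 * Real.pi / l ^ 2 = (2 * α / l) ^ 2 * (Real.pi / 2) by field_simp,
      Real.sqrt_mul (by positivity), Real.sqrt_sq (by positivity)]
  rw [h2] at h1
  calc _ ≤ 2 * α / l * √(Real.pi / 2) * b * (1 / (2 * α / l * √(Real.pi / 2)) * thetaConst) :=
        mul_le_mul_of_nonneg_left h1 (by positivity)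
    _ = _ := by
        have : 0 < √(Real.pi / 2) := by positivity
        field_simp

/-- The Gaussian weights confine `p'` to a window of width `ħ/α` around `p`, so that the momentum
average may be replaced by the value at `p`. -/
theorem norm_pairingTerm_sub_le {L : ℝ} (hL : 0 ≤ L)
    (hLip : ∀ n p p', ‖fourierSlice σ n p' - fourierSlice σ n p‖ ≤ L * |p' - p|) (n k : ℤ) :
    ‖pairingTerm σ hbar α m t x (n, k) -
      ((2 * α / l * √(Real.pi / 2) * Real.exp (-(α * freq l n) ^ 2 / 2) *
        pairWeight l α (x.2 / hbar) (n, k) : ℝ) : ℂ) *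
        (Complex.exp (freq l n * x.1 * Complex.I) *
        Complex.exp (-(pairPhase hbar m l t (n, k)) * Complex.I)) * fourierSlice σ n x.2‖ ≤
      hbar / α * (4 * α * √Real.pi / l * L) *
        Real.exp (-α ^ 2 * (freq l k + freq l n / 2 - x.2 / hbar) ^ 2) := by
  set u := freq l k + freq l n / 2 with hu
  have hw := integrable_pairWeight (l := l) hh hα (n, k)
  have hfs : Integrable fun p => (pairWeight l α (p / hbar) (n, k) : ℂ) * fourierSlice σ n p := by
    obtain ⟨b, -, hb⟩ := exists_summable_fourierSlice_bound σ hl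
    exact hw.ofReal.mul_bdd (c := b n) (continuous_fourierSlice hl σ n).aestronglyMeasurable
      (Eventually.of_forall fun p => hb n p)
  have e1 : momentumAverage σ hbar α (n, k) -
      ((Real.exp (-(α * freq l n) ^ 2 / 2) * (hbar / α * √(Real.pi / 2)) : ℝ) : ℂ) *
        fourierSlice σ n x.2 = ∫ p, (pairWeight l α (p / hbar) (n, k) : ℂ) *
          (fourierSlice σ n p - fourierSlice σ n x.2) := by
    rw [← integral_pairWeight hh hα (n, k), ← integral_complex_ofReal, ← integral_mul_const,
      momentumAverage]
    refine (integral_sub hfs (hw.ofReal.mul_const _)).symm.trans ?_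
    exact integral_congr_ae (Eventually.of_forall fun p => (mul_sub _ _ _).symm)
  have e2 : pairingTerm σ hbar α m t x (n, k) -
      ((2 * α / l * √(Real.pi / 2) * Real.exp (-(α * freq l n) ^ 2 / 2) *
        pairWeight l α (x.2 / hbar) (n, k) : ℝ) : ℂ) *
        (Complex.exp (freq l n * x.1 * Complex.I) *
        Complex.exp (-(pairPhase hbar m l t (n, k)) * Complex.I)) * fourierSlice σ n x.2 =
      ((2 * α ^ 2 / (hbar * l) * pairWeight l α (x.2 / hbar) (n, k) : ℝ) : ℂ) *
        (Complex.exp (freq l n * x.1 * Complex.I) *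
        Complex.exp (-(pairPhase hbar m l t (n, k)) * Complex.I)) *
        (∫ p, (pairWeight l α (p / hbar) (n, k) : ℂ) *
          (fourierSlice σ n p - fourierSlice σ n x.2)) := by
    rw [← e1, pairingTerm]
    have hlc : (l : ℂ) ≠ 0 := by exact_mod_cast hl.ne'
    have hhc : (hbar : ℂ) ≠ 0 := by exact_mod_cast hh.ne'
    have hαc : (α : ℂ) ≠ 0 := by exact_mod_cast hα.ne'
    push_cast
    field_simp
  have hnp := norm_pairing_phases (hbar := hbar) (l := l) m t x (n, k)
  simp only at hnp
  have hw0 := pairWeight_nonneg l α (x.2 / hbar) (n, k)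
  rw [e2, norm_mul, norm_mul, hnp, mul_one, Complex.norm_real,
    Real.norm_of_nonneg (mul_nonneg (by positivity) hw0), ← Real.norm_of_nonneg hw0,
    mul_assoc, ← Complex.norm_real (pairWeight l α (x.2 / hbar) (n, k)), ← norm_mul,
    ← integral_const_mul]
  obtain ⟨hgi, hgv⟩ := gaussian_momentum hh (b := α ^ 2) (by positivity) u
  set g : ℝ → ℝ := fun p => Real.exp (-α ^ 2 * (u - p / hbar) ^ 2) with hg
  have hpt : ∀ p, ‖(pairWeight l α (x.2 / hbar) (n, k) : ℂ) *
      ((pairWeight l α (p / hbar) (n, k) : ℂ) *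
        (fourierSlice σ n p - fourierSlice σ n x.2))‖ ≤
      2 * L * (hbar / α) * g x.2 * g p := by
    intro p
    -- in units of `ħ/α`, `|p - x.2|` is at most the sum of the distances `|y|`, `|y₀|` to `ħu`,
    -- and these factors are absorbed by half of the Gaussian exponents
    set y := α * (u - p / hbar) with hy
    set y₀ := α * (u - x.2 / hbar) with hy₀
    have h1 : pairWeight l α (p / hbar) (n, k) ≤ Real.exp (-2 * y ^ 2) := by
      refine (pairWeight_le _ _).trans (le_of_eq ?_)
      congr 1; rw [hy, hu]; ring
    have h2 : pairWeight l α (x.2 / hbar) (n, k) ≤ Real.exp (-2 * y₀ ^ 2) := by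
      refine (pairWeight_le _ _).trans (le_of_eq ?_)
      congr 1; rw [hy₀, hu]; ring
    have h3 : |p - x.2| ≤ hbar / α * (|y| + |y₀|) := by
      have : p - x.2 = hbar / α * (y₀ - y) := by rw [hy, hy₀]; field_simp; ring
      rw [this, abs_mul, abs_of_pos (by positivity : 0 < hbar / α)]
      refine mul_le_mul_of_nonneg_left ?_ (by positivity)
      have := abs_sub y₀ y
      linarith
    have h4 : g p = Real.exp (-y ^ 2) := by rw [hg, hy]; simp only; congr 1; ring
    have h5 : g x.2 = Real.exp (-y₀ ^ 2) := by rw [hg, hy₀]; simp only; congr 1; ring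
    have h6 : ∀ r : ℝ, Real.exp (-2 * r ^ 2) ≤ Real.exp (-r ^ 2) := fun r =>
      Real.exp_le_exp.2 (by nlinarith [sq_nonneg r])
    rw [norm_mul, norm_mul, Complex.norm_real, Complex.norm_real, Real.norm_of_nonneg hw0,
      Real.norm_of_nonneg (pairWeight_nonneg _ _ _ _), h4, h5]
    calc _ ≤ Real.exp (-2 * y₀ ^ 2) * (Real.exp (-2 * y ^ 2) *
          (L * (hbar / α * (|y| + |y₀|)))) := by
          refine mul_le_mul h2 (mul_le_mul h1 ((hLip n _ _).trans ?_) (norm_nonneg _)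
            (Real.exp_pos _).le) (mul_nonneg (pairWeight_nonneg _ _ _ _) (norm_nonneg _))
            (Real.exp_pos _).le
          exact mul_le_mul_of_nonneg_left h3 hL
      _ = L * (hbar / α) * (Real.exp (-2 * y₀ ^ 2) * (|y| * Real.exp (-2 * y ^ 2)) +
          (|y₀| * Real.exp (-2 * y₀ ^ 2)) * Real.exp (-2 * y ^ 2)) := by ring
      _ ≤ L * (hbar / α) * (Real.exp (-y₀ ^ 2) * Real.exp (-y ^ 2) +
          Real.exp (-y₀ ^ 2) * Real.exp (-y ^ 2)) := by
          refine mul_le_mul_of_nonneg_left (add_le_add ?_ ?_) (by positivity)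
          · exact mul_le_mul (h6 _) (abs_mul_exp_neg_le _) (by positivity) (Real.exp_pos _).le
          · exact mul_le_mul (abs_mul_exp_neg_le _) (h6 _) (by positivity) (Real.exp_pos _).le
      _ = _ := by ring
  have hI := norm_integral_le_of_norm_le (hgi.const_mul (2 * L * (hbar / α) * g x.2))
    (Eventually.of_forall hpt)
  have hJ : ∫ p, 2 * L * (hbar / α) * g x.2 * g p =
      2 * L * (hbar / α) * g x.2 * (hbar * (√Real.pi / α)) := by
    rw [integral_const_mul, show ∫ p, g p = _ from hgv, Real.sqrt_div' _ (by positivity),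
      Real.sqrt_sq hα.le]
  rw [hJ] at hI
  calc _ ≤ 2 * α ^ 2 / (hbar * l) * (2 * L * (hbar / α) * g x.2 * (hbar * (√Real.pi / α))) :=
        mul_le_mul_of_nonneg_left hI (by positivity)
    _ = _ := by
        simp only [hg]
        field_simp
        ring

/-- The sum over the modes with the momentum average evaluated at `p`, transformed by Poisson
summation. -/
theorem tsum_main_term (hm : 0 < m) (c : ℝ) (n : ℤ) {s ρ : ℝ}
    (hs : s = t - c * revivalTime hbar m l)
    (hρ : ρ = 2 * c * n + s * hbar * freq l n / (2 * m * l)) :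
    ∑' k : ℤ, ((2 * α / l * √(Real.pi / 2) * Real.exp (-(α * freq l n) ^ 2 / 2) *
        pairWeight l α (x.2 / hbar) (n, k) : ℝ) : ℂ) *
        (Complex.exp (freq l n * x.1 * Complex.I) *
        Complex.exp (-(pairPhase hbar m l t (n, k)) * Complex.I)) * fourierSlice σ n x.2 =
      fourierSlice σ n x.2 * (Complex.exp (freq l n * x.1 * Complex.I) *
        Complex.exp (-(Real.pi * ρ * n) * Complex.I)) *
        ((Real.exp (-(α * freq l n) ^ 2) : ℝ) : ℂ) *
        ∑' j : ℤ, ((Real.exp (-Real.pi / (2 * α ^ 2 * Real.pi / l ^ 2) * (j + ρ) ^ 2) : ℝ) : ℂ) *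
          Complex.exp (-(2 * Real.pi * (x.2 / hbar * l / Real.pi - n / 2) * (j + ρ) : ℝ) *
            Complex.I) := by
  have hP := tsum_gaussian_mul_character (a := 2 * α ^ 2 * Real.pi / l ^ 2) (by positivity)
    (x.2 / hbar * l / Real.pi - n / 2) ρ
  have hsq : √(2 * α ^ 2 * Real.pi / l ^ 2) = 2 * α / l * √(Real.pi / 2) := by
    rw [show 2 * α ^ 2 * Real.pi / l ^ 2 = (2 * α / l) ^ 2 * (Real.pi / 2) by field_simp,
      Real.sqrt_mul (by positivity), Real.sqrt_sq (by positivity)]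
  have hsq0 : (2 * α / l * √(Real.pi / 2) : ℝ) ≠ 0 := by positivity
  have hphase : ∀ k : ℤ, Complex.exp (-(pairPhase hbar m l t (n, k)) * Complex.I) =
      Complex.exp (-(Real.pi * ρ * n) * Complex.I) *
        Complex.exp (-(2 * Real.pi * ρ * k : ℝ) * Complex.I) := by
    intro k
    rw [← Complex.exp_add, ← add_mul]
    congr 2
    have : -pairPhase hbar m l t (n, k) = -(Real.pi * ρ * n) + -(2 * Real.pi * ρ * k) := by
      have ht : t = s + c * revivalTime hbar m l := by rw [hs]; ring
      rw [pairPhase, hρ, ht, revivalTime]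
      simp only [freq]
      field_simp
      ring
    exact_mod_cast congrArg (fun r : ℝ => (r : ℂ)) this
  have hterm : ∀ k : ℤ, ((2 * α / l * √(Real.pi / 2) * Real.exp (-(α * freq l n) ^ 2 / 2) *
        pairWeight l α (x.2 / hbar) (n, k) : ℝ) : ℂ) *
        (Complex.exp (freq l n * x.1 * Complex.I) *
        Complex.exp (-(pairPhase hbar m l t (n, k)) * Complex.I)) * fourierSlice σ n x.2 =
      (fourierSlice σ n x.2 * (Complex.exp (freq l n * x.1 * Complex.I) *
        Complex.exp (-(Real.pi * ρ * n) * Complex.I)) *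
        ((Real.exp (-(α * freq l n) ^ 2) : ℝ) : ℂ) * ((2 * α / l * √(Real.pi / 2) : ℝ) : ℂ)) *
      (((Real.exp (-Real.pi * (2 * α ^ 2 * Real.pi / l ^ 2) *
        (k - (x.2 / hbar * l / Real.pi - n / 2)) ^ 2) : ℝ) : ℂ) *
        Complex.exp (-(2 * Real.pi * ρ * k : ℝ) * Complex.I)) := by
    intro k
    have hE : Real.exp (-(α * freq l n) ^ 2) =
        Real.exp (-(α * freq l n) ^ 2 / 2) * Real.exp (-(α * freq l n) ^ 2 / 2) := by
      rw [← Real.exp_add]; congr 1; ring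
    rw [hphase, pairWeight_eq, gaussian_freq_eq hl, hE]
    push_cast
    ring
  simp only [hterm]
  rw [tsum_mul_left, hP, hsq]
  have hc : ((2 * α / l * √(Real.pi / 2) : ℝ) : ℂ) *
      ((1 / (2 * α / l * √(Real.pi / 2)) : ℝ) : ℂ) = 1 := by
    rw [← Complex.ofReal_mul, mul_one_div_cancel hsq0, Complex.ofReal_one]
  rw [mul_assoc, ← mul_assoc (((2 * α / l * √(Real.pi / 2) : ℝ)) : ℂ), hc, one_mul]

/-- The total error of evaluating the momentum averages at `p` is of order `ħ/α`. -/
theorem norm_tsum_pairingTerm_sub_le (hα1 : 2 * α ^ 2 * Real.pi / l ^ 2 ≤ 1) {L : ℝ} (hL : 0 ≤ L)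
    (hLip : ∀ n p p', ‖fourierSlice σ n p' - fourierSlice σ n p‖ ≤ L * |p' - p|) (n : ℤ) :
    ‖∑' k : ℤ, pairingTerm σ hbar α m t x (n, k) - ∑' k : ℤ,
      ((2 * α / l * √(Real.pi / 2) * Real.exp (-(α * freq l n) ^ 2 / 2) *
        pairWeight l α (x.2 / hbar) (n, k) : ℝ) : ℂ) *
        (Complex.exp (freq l n * x.1 * Complex.I) *
        Complex.exp (-(pairPhase hbar m l t (n, k)) * Complex.I)) * fourierSlice σ n x.2‖ ≤
      hbar / α * (4 * L * thetaConst) := by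
  have hs := summable_gaussian_freq hl (b := α ^ 2) (by positivity) (x.2 / hbar) n
  have hs2 := summable_gaussian_freq hl (b := 2 * α ^ 2) (by positivity) (x.2 / hbar) n
  have hsum1 : Summable fun k : ℤ => pairingTerm σ hbar α m t x (n, k) :=
    (hasSum_pairing hl hh hα m t x σ).summable.comp_injective
      (i := fun k : ℤ => (n, k)) (Prod.mk_right_injective n)
  have hsum2 : Summable fun k : ℤ =>
      ((2 * α / l * √(Real.pi / 2) * Real.exp (-(α * freq l n) ^ 2 / 2) *
        pairWeight l α (x.2 / hbar) (n, k) : ℝ) : ℂ) *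
        (Complex.exp (freq l n * x.1 * Complex.I) *
        Complex.exp (-(pairPhase hbar m l t (n, k)) * Complex.I)) * fourierSlice σ n x.2 := by
    refine Summable.of_norm_bounded (hs2.mul_left (2 * α / l * √(Real.pi / 2) *
      Real.exp (-(α * freq l n) ^ 2 / 2) * ‖fourierSlice σ n x.2‖)) fun k => ?_
    have hnp := norm_pairing_phases (hbar := hbar) (l := l) m t x (n, k)
    simp only at hnp
    rw [norm_mul, norm_mul, hnp, mul_one, Complex.norm_real,
      Real.norm_of_nonneg (mul_nonneg (by positivity) (pairWeight_nonneg _ _ _ _))]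
    have := mul_le_mul_of_nonneg_left (pairWeight_le (l := l) (α := α) (x.2 / hbar) (n, k))
      (by positivity : 0 ≤ 2 * α / l * √(Real.pi / 2) *
      Real.exp (-(α * freq l n) ^ 2 / 2) * ‖fourierSlice σ n x.2‖)
    calc _ = 2 * α / l * √(Real.pi / 2) * Real.exp (-(α * freq l n) ^ 2 / 2) *
        ‖fourierSlice σ n x.2‖ * pairWeight l α (x.2 / hbar) (n, k) := by ring
      _ ≤ _ := this
  rw [← hsum1.tsum_sub hsum2]
  refine (tsum_of_norm_bounded (hs.mul_left _).hasSum
    (norm_pairingTerm_sub_le hl hh hα m t x σ hL hLip n)).trans ?_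
  rw [tsum_mul_left]
  have hb1 : α ^ 2 * Real.pi / l ^ 2 ≤ 1 := by
    refine le_trans ?_ hα1
    gcongr
    nlinarith [sq_nonneg α]
  have h1 := tsum_gaussian_freq_le hl (b := α ^ 2) (by positivity) hb1 (x.2 / hbar) n
  have h2 : √(α ^ 2 * Real.pi / l ^ 2) = α / l * √Real.pi := by
    rw [show α ^ 2 * Real.pi / l ^ 2 = (α / l) ^ 2 * Real.pi by field_simp,
      Real.sqrt_mul (by positivity), Real.sqrt_sq (by positivity)]
  rw [h2] at h1
  calc _ ≤ hbar / α * (4 * α * √Real.pi / l * L) * (1 / (α / l * √Real.pi) * thetaConst) :=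
        mul_le_mul_of_nonneg_left h1 (by positivity)
    _ = _ := by
        have : 0 < √Real.pi := by positivity
        field_simp

end mode

/-! ### The limit of each Fourier mode -/

/-- The resonant term of the dual sum, multiplied by the phases in front of it. The shift `n/2` of the
summation index cancels, and the momentum enters through the displacement `-(p/m) s` only. -/
theorem resonant_term {l hbar α m : ℝ} (hl : 0 < l) (hh : 0 < hbar) (hα : 0 < α) (hm : 0 < m)
    (c s : ℝ) (x : ℝ × ℝ) (n : ℤ) {ρ : ℝ}
    (hρ : ρ = 2 * c * n + s * hbar * freq l n / (2 * m * l)) :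
    (Complex.exp (freq l n * x.1 * Complex.I) * Complex.exp (-(Real.pi * ρ * n) * Complex.I)) *
      (∑' j : ℤ, if (j : ℝ) + 2 * c * n = 0 then
        ((Real.exp (-Real.pi / (2 * α ^ 2 * Real.pi / l ^ 2) * (j + ρ) ^ 2) : ℝ) : ℂ) *
          Complex.exp (-(2 * Real.pi * (x.2 / hbar * l / Real.pi - n / 2) * (j + ρ) : ℝ) *
            Complex.I) else 0) =
      resonance c n * Complex.exp (freq l n * (x.1 - x.2 / m * s : ℝ) * Complex.I) *
        ((Real.exp (-(hbar / α * s * (freq l n / m)) ^ 2 / 8) : ℝ) : ℂ) := by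
  by_cases h : ∃ j : ℤ, (j : ℝ) = 2 * c * n
  · obtain ⟨j₀, hj₀⟩ := h
    rw [tsum_eq_single (-j₀)]
    · have e0 : (((-j₀ : ℤ) : ℝ) + 2 * c * n = 0) := by push_cast; linarith
      have e1 : ((-j₀ : ℤ) : ℝ) + ρ = s * hbar * freq l n / (2 * m * l) := by
        rw [hρ]; push_cast; linarith
      rw [if_pos e0, e1, resonance, if_pos ⟨j₀, hj₀⟩]
      have e2 : -Real.pi / (2 * α ^ 2 * Real.pi / l ^ 2) *
          (s * hbar * freq l n / (2 * m * l)) ^ 2 = -(hbar / α * s * (freq l n / m)) ^ 2 / 8 := by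
        field_simp
        ring
      have e3 : (freq l n * x.1 * Complex.I : ℂ) + -(Real.pi * ρ * n) * Complex.I +
          -(2 * Real.pi * (x.2 / hbar * l / Real.pi - n / 2) *
            (s * hbar * freq l n / (2 * m * l)) : ℝ) * Complex.I =
          -(2 * Real.pi * c * n ^ 2) * Complex.I +
            freq l n * (x.1 - x.2 / m * s : ℝ) * Complex.I := by
        have : freq l n * x.1 + -(Real.pi * ρ * n) +
          -(2 * Real.pi * (x.2 / hbar * l / Real.pi - n / 2) *
            (s * hbar * freq l n / (2 * m * l))) =
          -(2 * Real.pi * c * n ^ 2) + freq l n * (x.1 - x.2 / m * s) := by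
          rw [hρ]
          field_simp [Real.pi_ne_zero]
          ring
        have h2 := congrArg (fun r : ℝ => (r : ℂ) * Complex.I) this
        push_cast at h2 ⊢
        linear_combination h2
      rw [e2, mul_left_comm, ← Complex.exp_add, ← Complex.exp_add, e3, Complex.exp_add]
      ring
    · intro j hj
      rw [if_neg]
      intro h0
      apply hj
      have : (j : ℝ) = ((-j₀ : ℤ) : ℝ) := by push_cast; linarith
      exact_mod_cast this
  · rw [resonance, if_neg h, zero_mul, zero_mul]
    have : ∀ j : ℤ, ¬ ((j : ℝ) + 2 * c * n = 0) := fun j h0 =>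
      h ⟨-j, by push_cast; linarith⟩
    simp [this]

/-- The damping of the resonant term converges to the Fourier transform of `φ_D`. For `D = ∞` it
kills every mode except `n = 0`. -/
theorem tendsto_spreadFactor {J : Type*} {G : Filter J} {l m : ℝ} (hl : 0 < l) (hm : 0 < m)
    {D : ℝ≥0∞} {r : J → ℝ}
    (hr : Tendsto (fun i => (r i : EReal)) G (𝓝 (((2 * m : ℝ) : EReal) * (D : EReal)))) (n : ℤ) :
    Tendsto (fun i => Real.exp (-(r i * (freq l n / m)) ^ 2 / 8)) G (𝓝 (spreadFactor l D n)) := by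
  rcases eq_or_ne n 0 with rfl | hn
  · simpa [spreadFactor, freq] using tendsto_const_nhds
  rcases eq_or_ne D ⊤ with rfl | hD
  · rw [EReal.coe_ennreal_top, EReal.coe_mul_top_of_pos (by positivity),
      EReal.tendsto_coe_nhds_top_iff] at hr
    simp only [spreadFactor, hn, if_false, if_true]
    have hk : 0 < (freq l n / m) ^ 2 / 8 := by
      have := freq_ne_zero hl hn
      positivity
    have h1 : Tendsto (fun i => r i ^ 2 * ((freq l n / m) ^ 2 / 8)) G atTop :=
      ((tendsto_pow_atTop two_ne_zero).comp hr).atTop_mul_const hk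
    refine (Real.tendsto_exp_neg_atTop_nhds_zero.comp h1).congr fun i => ?_
    simp only [Function.comp]
    congr 1
    ring
  · lift D to NNReal using hD
    have e : ((2 * m : ℝ) : EReal) * (((D : ℝ≥0∞)) : EReal) = ((2 * m * D : ℝ) : EReal) := by
      rw [show ((D : ℝ≥0∞) : EReal) = ((D : ℝ) : EReal) from rfl, ← EReal.coe_mul]
    rw [e, EReal.tendsto_coe] at hr
    simp only [spreadFactor, hn, ENNReal.coe_ne_top, if_false, ENNReal.coe_toReal]
    have h1 : Tendsto (fun i => -(r i * (freq l n / m)) ^ 2 / 8) G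
        (𝓝 (-(2 * m * D * (freq l n / m)) ^ 2 / 8)) :=
      (((hr.mul_const _).pow 2).neg).div_const _
    have e2 : -(2 * m * D * (freq l n / m)) ^ 2 / 8 = -(D * freq l n) ^ 2 / 2 := by
      field_simp; ring
    rw [e2] at h1
    exact (Real.continuous_exp.tendsto _).comp h1

/-- The `n`-th Fourier mode of the limit distribution, applied to `σ`. -/
def limitTerm {l : ℝ} (σ : TestFun l) (D : ℝ≥0∞) (c m s : ℝ) (x : ℝ × ℝ) (n : ℤ) : ℂ :=
  fourierSlice σ n x.2 * resonance c n *
    Complex.exp (freq l n * (x.1 - x.2 / m * s : ℝ) * Complex.I) * spreadFactor l D n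

theorem norm_limitTerm_le {l : ℝ} (σ : TestFun l) (D : ℝ≥0∞) (c m s : ℝ) (x : ℝ × ℝ) (n : ℤ) :
    ‖limitTerm σ D c m s x n‖ ≤ ‖fourierSlice σ n x.2‖ := by
  rw [limitTerm, norm_mul, norm_mul, norm_mul, Complex.norm_real,
    Real.norm_of_nonneg (spreadFactor_nonneg _ _ _)]
  norm_cast
  rw [Complex.norm_exp_ofReal_mul_I, mul_one]
  refine (mul_le_of_le_one_right (by positivity) (spreadFactor_le_one _ _ _)).trans ?_
  exact mul_le_of_le_one_right (norm_nonneg _) (norm_resonance_le c n)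

section limit

variable {J : Type*} {G : Filter J} {l m : ℝ} (hl : 0 < l) (hm : 0 < m)
  {hbar α t : J → ℝ} {x : J → ℝ × ℝ} (hh : ∀ i, 0 < hbar i) (hα : ∀ i, 0 < α i)
  {c : ℝ} {D : ℝ≥0∞}
  (hlim_α : Tendsto α G (𝓝 0))
  (hlim_ratio : Tendsto (fun i => hbar i / α i) G (𝓝 0))
  (hlim_D : Tendsto
    (fun i => ((hbar i / α i * (t i - c * revivalTime (hbar i) m l) : ℝ) : EReal))
    G (𝓝 (((2 * m : ℝ) : EReal) * (D : EReal))))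
  (hlim_c : Tendsto (fun i => hbar i * (t i - c * revivalTime (hbar i) m l)) G (𝓝 0))
  (σ : TestFun l)
include hl hm hh hα hlim_α hlim_ratio hlim_D hlim_c

/-- Each Fourier mode of the pairing approaches the corresponding mode of the limit. The points
`x i = (q, p)` are arbitrary, so the convergence is uniform in them. -/
theorem tendsto_mode_sub_limitTerm (n : ℤ) :
    Tendsto (fun i => ∑' k : ℤ, pairingTerm σ (hbar i) (α i) m (t i) (x i) (n, k) -
      limitTerm σ D c m (t i - c * revivalTime (hbar i) m l) (x i) n) G (𝓝 0) := by
  obtain ⟨b, -, hb⟩ := exists_summable_fourierSlice_bound σ hl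
  obtain ⟨L, hL, hLip⟩ := exists_fourierSlice_lipschitz σ hl
  have hbn : 0 ≤ b n := (norm_nonneg _).trans (hb n 0)
  set s : J → ℝ := fun i => t i - c * revivalTime (hbar i) m l with hs
  set a : J → ℝ := fun i => 2 * α i ^ 2 * Real.pi / l ^ 2 with ha
  set ρ : J → ℝ := fun i => 2 * c * n + s i * hbar i * freq l n / (2 * m * l) with hρ
  have ha_pos : ∀ i, 0 < a i := fun i => by have := hα i; simp only [ha]; positivity
  have ha0 : Tendsto a G (𝓝 0) := by
    simpa using (((hlim_α.pow 2).const_mul 2).mul_const Real.pi).div_const (l ^ 2)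
  have hρ0 : Tendsto ρ G (𝓝 (2 * c * n)) := by
    have h := ((hlim_c.mul_const (freq l n)).div_const (2 * m * l)).const_add (2 * c * n)
    rw [zero_mul, zero_div, add_zero] at h
    refine h.congr fun i => ?_
    simp only [hρ, hs]
    ring
  have hSR := tendsto_tsum_gaussian_sub_resonant
    (v := fun i => (x i).2 / hbar i * l / Real.pi - n / 2) ha_pos ha0 hρ0
  have hsp := tendsto_spreadFactor hl hm hlim_D n
  have hE : Tendsto (fun i => Real.exp (-(α i * freq l n) ^ 2)) G (𝓝 1) := by
    have h := ((hlim_α.mul_const (freq l n)).pow 2).neg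
    have h2 := (Real.continuous_exp.tendsto _).comp h
    simpa using! h2
  set S : J → ℂ := fun i => ∑' j : ℤ, ((Real.exp (-Real.pi / a i * (j + ρ i) ^ 2) : ℝ) : ℂ) *
    Complex.exp (-(2 * Real.pi * ((x i).2 / hbar i * l / Real.pi - n / 2) * (j + ρ i) : ℝ) *
      Complex.I) with hS
  set R : J → ℂ := fun i => ∑' j : ℤ, if (j : ℝ) + 2 * c * n = 0 then
    ((Real.exp (-Real.pi / a i * (j + ρ i) ^ 2) : ℝ) : ℂ) *
    Complex.exp (-(2 * Real.pi * ((x i).2 / hbar i * l / Real.pi - n / 2) * (j + ρ i) : ℝ) *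
      Complex.I) else 0 with hR
  have hlim : Tendsto (fun i => hbar i / α i * (4 * L * thetaConst) +
      b n * (‖S i - R i‖ + |Real.exp (-(α i * freq l n) ^ 2) - 1| +
        |Real.exp (-(hbar i / α i * s i * (freq l n / m)) ^ 2 / 8) - spreadFactor l D n|))
      G (𝓝 0) := by
    have h1 := hlim_ratio.mul_const (4 * L * thetaConst)
    have h2 := hSR.norm
    have h3 := (hE.sub_const 1).abs
    have h4 := (hsp.sub_const (spreadFactor l D n)).abs
    have h5 := h1.add (((h2.add h3).add h4).const_mul (b n))
    simpa only [zero_mul, sub_self, abs_zero, norm_zero, add_zero, mul_zero] using h5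
  refine squeeze_zero_norm' ?_ hlim
  filter_upwards [ha0.eventually (gt_mem_nhds zero_lt_one)] with i hi
  have hmain := tsum_main_term hl (hh i) (hα i) m (t i) (x i) σ hm c n
    (s := s i) (ρ := ρ i) rfl rfl
  have happ := norm_tsum_pairingTerm_sub_le hl (hh i) (hα i) m (t i) (x i) σ hi.le hL hLip n
  rw [hmain] at happ
  have hres := resonant_term hl (hh i) (hα i) hm c (s i) (x i) n (ρ := ρ i) rfl
  set ph : ℂ := Complex.exp (freq l n * (x i).1 * Complex.I) *
    Complex.exp (-(Real.pi * ρ i * n) * Complex.I) with hph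
  have hphn : ‖ph‖ = 1 := by
    rw [hph, norm_mul]
    norm_cast
    rw [Complex.norm_exp_ofReal_mul_I, Complex.norm_exp_ofReal_mul_I, one_mul]
  set e : ℝ := Real.exp (-(hbar i / α i * s i * (freq l n / m)) ^ 2 / 8) with he
  set E : ℝ := Real.exp (-(α i * freq l n) ^ 2) with hEdef
  have hE1 : E ≤ 1 := Real.exp_le_one_iff.2 (by nlinarith [sq_nonneg (α i * freq l n)])
  have hE0 : 0 < E := Real.exp_pos _
  have he1 : e ≤ 1 :=
    Real.exp_le_one_iff.2 (by nlinarith [sq_nonneg (hbar i / α i * s i * (freq l n / m))])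
  have he0 : 0 < e := Real.exp_pos _
  set w : ℂ := resonance c n *
    Complex.exp (freq l n * ((x i).1 - (x i).2 / m * s i : ℝ) * Complex.I) with hw
  have hwn : ‖w‖ ≤ 1 := by
    rw [hw, norm_mul]
    norm_cast
    rw [Complex.norm_exp_ofReal_mul_I, mul_one]
    exact norm_resonance_le c n
  have hres' : ph * R i = w * (e : ℂ) := hres
  set f := fourierSlice σ n (x i).2 with hf
  have hfb : ‖f‖ ≤ b n := hb n _
  have hL' : limitTerm σ D c m (s i) (x i) n = f * w * (spreadFactor l D n : ℂ) := by
    rw [limitTerm, hw, hf]; ring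
  set P := ∑' k : ℤ, pairingTerm σ (hbar i) (α i) m (t i) (x i) (n, k) with hP
  -- errors of the momentum average, of the nonresonant terms, of `exp (-α²κ_n²) ≈ 1` and of the damping
  have hsplit : P - limitTerm σ D c m (s i) (x i) n = (P - f * ph * (E : ℂ) * S i) +
      f * (ph * (E : ℂ) * (S i - R i) + w * ((e : ℂ) * ((E - 1 : ℝ) : ℂ)) +
        w * ((e - spreadFactor l D n : ℝ) : ℂ)) := by
    rw [hL']
    push_cast
    linear_combination (f * E) * hres'
  rw [hsplit]
  refine (norm_add_le _ _).trans (add_le_add happ ?_)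
  rw [norm_mul]
  refine mul_le_mul hfb ?_ (norm_nonneg _) hbn
  refine (norm_add₃_le).trans ?_
  have n1 : ‖ph * (E : ℂ) * (S i - R i)‖ ≤ ‖S i - R i‖ := by
    rw [norm_mul, norm_mul, hphn, one_mul, Complex.norm_real, Real.norm_of_nonneg hE0.le]
    exact mul_le_of_le_one_left (norm_nonneg _) hE1
  have n2 : ‖w * ((e : ℂ) * ((E - 1 : ℝ) : ℂ))‖ ≤ |E - 1| := by
    rw [norm_mul w, norm_mul (e : ℂ), Complex.norm_real, Complex.norm_real, Real.norm_of_nonneg he0.le,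
      Real.norm_eq_abs]
    calc _ ≤ 1 * (1 * |E - 1|) := by gcongr
      _ = _ := by ring
  have n3 : ‖w * ((e - spreadFactor l D n : ℝ) : ℂ)‖ ≤ |e - spreadFactor l D n| := by
    rw [norm_mul w, Complex.norm_real, Real.norm_eq_abs]
    exact mul_le_of_le_one_left (abs_nonneg _) hwn
  linarith

/-- Dominated convergence over the Fourier modes of the test function. -/
theorem tendsto_pairing_sub_tsum_limitTerm :
    Tendsto (fun i => ((∫ x' in strip l, transitionDensity (hbar i) (α i) m l (t i) (x i) x' * σ x' :
        ℝ) : ℂ) - ∑' n, limitTerm σ D c m (t i - c * revivalTime (hbar i) m l) (x i) n)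
      G (𝓝 0) := by
  obtain ⟨b, hbs, hb⟩ := exists_summable_fourierSlice_bound σ hl
  have ha0 : Tendsto (fun i => 2 * α i ^ 2 * Real.pi / l ^ 2) G (𝓝 0) := by
    simpa using (((hlim_α.pow 2).const_mul 2).mul_const Real.pi).div_const (l ^ 2)
  have h := tendsto_tsum_of_dominated_convergence (𝓕 := G)
    (bound := fun n => thetaConst * b n + b n) ((hbs.mul_left thetaConst).add hbs)
    (fun n => tendsto_mode_sub_limitTerm (x := x) hl hm hh hα hlim_α hlim_ratio hlim_D hlim_c σ n)
    (by
      filter_upwards [ha0.eventually (gt_mem_nhds zero_lt_one)] with i hi n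
      refine (norm_sub_le _ _).trans (add_le_add ?_ ((norm_limitTerm_le _ _ _ _ _ _ _).trans
        (hb n _)))
      exact norm_tsum_pairingTerm_le hl (hh i) (hα i) m (t i) (x i) σ hi.le (hb n))
  rw [tsum_zero] at h
  refine h.congr fun i => ?_
  have hp : HasSum (pairingTerm σ (hbar i) (α i) m (t i) (x i)) _ :=
    hasSum_pairing hl (hh i) (hα i) m (t i) (x i) σ
  have hp1 := hp.prod_fiberwise fun n => (hp.summable.comp_injective
      (i := fun k : ℤ => (n, k)) (Prod.mk_right_injective n)).hasSum
  have hp2 : Summable fun n => limitTerm σ D c m (t i - c * revivalTime (hbar i) m l) (x i) n :=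
    Summable.of_norm_bounded hbs fun n => (norm_limitTerm_le _ _ _ _ _ _ _).trans (hb n _)
  rw [← hp1.tsum_eq, ← hp1.summable.tsum_sub hp2]
  rfl

end limit

/-! ### Identification of the limit -/

/-- For rational `c = r` the resonant modes are the multiples of the number of packets. -/
theorem exists_int_eq_two_mul_iff_numPackets_dvd (r : ℚ) (n : ℤ) :
    (∃ j : ℤ, (j : ℝ) = 2 * r * n) ↔ ((numPackets r.den : ℕ) : ℤ) ∣ n := by
  have hd : (r.den : ℝ) ≠ 0 := by exact_mod_cast r.den_nz
  have hr : (r : ℝ) = r.num / r.den := by exact_mod_cast (Rat.num_div_den r).symm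
  have h1 : (∃ j : ℤ, (j : ℝ) = 2 * r * n) ↔ (r.den : ℤ) ∣ r.num * (2 * n) := by
    constructor
    · rintro ⟨j, hj⟩
      refine ⟨j, ?_⟩
      rw [hr] at hj
      field_simp at hj
      have : ((r.num * (2 * n) : ℤ) : ℝ) = ((r.den * j : ℤ) : ℝ) := by push_cast; linarith
      exact_mod_cast this
    · rintro ⟨j, hj⟩
      refine ⟨j, ?_⟩
      have : ((r.num * (2 * n) : ℤ) : ℝ) = ((r.den * j : ℤ) : ℝ) := by rw [hj]
      rw [hr]
      push_cast at this
      field_simp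
      linarith
  have hcop : IsCoprime (r.den : ℤ) r.num := by
    rw [Int.isCoprime_iff_gcd_eq_one, Int.gcd_comm]
    exact r.reduced
  rw [h1, numPackets, show (r.den : ℤ) ∣ r.num * (2 * n) ↔ (r.den : ℤ) ∣ 2 * n from
    ⟨hcop.dvd_of_dvd_mul_left, fun h => dvd_mul_of_dvd_right h _⟩]
  split_ifs with he
  · obtain ⟨N, hN⟩ := he
    rw [hN, show (N + N) / 2 = N by omega]
    push_cast
    rw [← two_mul, mul_dvd_mul_iff_left two_ne_zero]
  · have hodd : IsCoprime (r.den : ℤ) 2 := by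
      rw [Int.isCoprime_iff_gcd_eq_one]
      exact (Nat.coprime_two_right.2 (Nat.not_even_iff_odd.1 he))
    exact ⟨hodd.dvd_of_dvd_mul_left, fun h => dvd_mul_of_dvd_right h _⟩

theorem numPackets_pos (r : ℚ) : 0 < numPackets r.den := by
  have := r.den_pos
  unfold numPackets
  split_ifs with h
  · obtain ⟨N, hN⟩ := h; omega
  · exact this

theorem exp_int_mul_pi_eq {j k : ℤ} (h : Even (j - k)) :
    Complex.exp (j * (Real.pi * Complex.I)) = Complex.exp (k * (Real.pi * Complex.I)) := by
  obtain ⟨d, hd⟩ := h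
  have : (j : ℂ) * (Real.pi * Complex.I) = k * (Real.pi * Complex.I) +
      d * (2 * Real.pi * Complex.I) := by
    have : (j : ℂ) = k + (d + d) := by
      have h2 : j = k + (d + d) := by omega
      rw [h2]; push_cast; ring
    rw [this]; ring
  rw [this, Complex.exp_add, Complex.exp_int_mul_two_pi_mul_I, mul_one]

/-- The phase of a resonant mode is that of a translation by the packet shift `a`. -/
theorem exp_packetShift {l : ℝ} (hl : 0 < l) (r : ℚ) (d : ℤ) :
    Complex.exp (freq l (numPackets r.den * d) * packetShift l r.den * Complex.I) =
      Complex.exp (-(2 * Real.pi * (r : ℝ) * ((numPackets r.den * d : ℤ) : ℂ) ^ 2) * Complex.I) := by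
  have hlc : (l : ℂ) ≠ 0 := by exact_mod_cast hl.ne'
  have hd : (r.den : ℂ) ≠ 0 := by exact_mod_cast r.den_nz
  have hr : ((r : ℝ) : ℂ) = r.num / r.den := by exact_mod_cast (Rat.num_div_den r).symm
  by_cases he : Even r.den
  · obtain ⟨N, hN⟩ := he
    have hN0 : (N : ℂ) ≠ 0 := by
      intro h0
      have : N = 0 := by exact_mod_cast h0
      exact r.den_nz (by omega)
    have hP : numPackets r.den = N := by
      rw [numPackets, if_pos ⟨N, hN⟩]; omega
    have hcop : r.num.natAbs.Coprime (N + N) := hN ▸ r.reduced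
    have hodd : Odd r.num := by
      rw [← Int.natAbs_odd, ← Nat.coprime_two_right]
      exact hcop.coprime_dvd_right ⟨N, by ring⟩
    have hrhs : (-(2 * Real.pi * (r : ℝ) * ((N * d : ℤ) : ℂ) ^ 2) * Complex.I : ℂ) =
        ((-(r.num * N * d ^ 2) : ℤ) : ℂ) * (Real.pi * Complex.I) := by
      rw [hr, hN]
      push_cast
      field_simp
      ring
    rw [hP, hrhs, packetShift]
    split_ifs with h4
    -- `N' = N` and the numerator are odd, so both sides equal `(-1)^d`
    · have hNodd : Odd (N : ℤ) := by
        rw [Int.odd_coe_nat]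
        exact Nat.odd_iff.2 (by omega)
      have hlhs : (freq l (N * d) * ((2 * l / r.den : ℝ) : ℂ) * Complex.I : ℂ) =
          (d : ℂ) * (Real.pi * Complex.I) := by
        rw [freq, hN]
        push_cast
        field_simp
        ring
      rw [hlhs]
      refine exp_int_mul_pi_eq ?_
      rw [sub_neg_eq_add, Int.even_add, Int.even_mul, Int.even_mul, Int.even_pow]
      simp only [Int.not_even_iff_odd.2 hodd, Int.not_even_iff_odd.2 hNodd]
      simp
    · have hNe : Even (N : ℤ) := by
        rw [Int.even_coe_nat]
        exact Nat.even_iff.2 (by omega)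
      have := exp_int_mul_pi_eq (j := 0) (k := -(r.num * N * d ^ 2))
        (by simp [hNe])
      simpa using this
  · have hP : numPackets r.den = r.den := by rw [numPackets, if_neg he]
    have h4 : ¬ r.den % 4 = 2 := fun h => he (Nat.even_iff.2 (by omega))
    have hrhs : (-(2 * Real.pi * (r : ℝ) * ((r.den * d : ℤ) : ℂ) ^ 2) * Complex.I : ℂ) =
        ((-(r.num * r.den * d ^ 2) : ℤ) : ℂ) * (2 * Real.pi * Complex.I) := by
      rw [hr]
      push_cast
      field_simp
    rw [hP, hrhs, Complex.exp_int_mul_two_pi_mul_I, packetShift, if_neg h4]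
    simp

/-- Averaging over the `N'` equidistant packets projects onto the resonant modes. -/
theorem sum_exp_packets {l : ℝ} (hl : 0 < l) (r : ℚ) (n : ℤ) :
    (1 / (numPackets r.den : ℂ)) * ∑ k ∈ Finset.range (numPackets r.den),
      Complex.exp (freq l n * (2 * k * l / numPackets r.den + packetShift l r.den : ℝ) *
        Complex.I) = resonance r n := by
  have hlc : (l : ℂ) ≠ 0 := by exact_mod_cast hl.ne'
  have hN := numPackets_pos r
  have hNc : (numPackets r.den : ℂ) ≠ 0 := by exact_mod_cast hN.ne'
  set ζ : ℂ := Complex.exp (2 * Real.pi * Complex.I * (n / numPackets r.den)) with hζ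
  have hterm : ∀ k : ℕ, Complex.exp (freq l n *
      (2 * k * l / numPackets r.den + packetShift l r.den : ℝ) * Complex.I) =
      Complex.exp (freq l n * packetShift l r.den * Complex.I) * ζ ^ k := by
    intro k
    rw [hζ, ← Complex.exp_nat_mul, ← Complex.exp_add]
    congr 1
    rw [freq]
    push_cast
    field_simp
    ring
  simp only [hterm]
  rw [← Finset.mul_sum, resonance]
  split_ifs with h
  · rw [exists_int_eq_two_mul_iff_numPackets_dvd] at h
    obtain ⟨d, rfl⟩ := h
    have h1 : ζ = 1 := by
      rw [hζ]
      rw [show (2 * Real.pi * Complex.I *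
        (((numPackets r.den : ℤ) * d : ℤ) / numPackets r.den) : ℂ) =
        d * (2 * Real.pi * Complex.I) by push_cast; field_simp]
      exact Complex.exp_int_mul_two_pi_mul_I d
    rw [exp_packetShift hl, h1]
    simp only [one_pow, Finset.sum_const, Finset.card_range, nsmul_eq_mul, mul_one]
    field_simp
  · rw [exists_int_eq_two_mul_iff_numPackets_dvd] at h
    have h1 : ζ ≠ 1 := by
      intro h1
      rw [hζ, Complex.exp_eq_one_iff] at h1
      obtain ⟨d, hd⟩ := h1
      apply h
      refine ⟨d, ?_⟩
      have h2 : (2 * Real.pi * Complex.I : ℂ) ≠ 0 := Complex.two_pi_I_ne_zero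
      have h3 : (n : ℂ) / numPackets r.den = d := by
        apply mul_left_cancel₀ h2
        rw [hd]; ring
      rw [div_eq_iff hNc] at h3
      have : (n : ℂ) = (((numPackets r.den : ℕ) : ℤ) * d : ℤ) := by
        rw [h3]; push_cast; ring
      exact_mod_cast this
    have h2 : ζ ^ numPackets r.den = 1 := by
      rw [hζ, ← Complex.exp_nat_mul, show (numPackets r.den : ℂ) *
        (2 * Real.pi * Complex.I * (n / numPackets r.den)) = n * (2 * Real.pi * Complex.I) by
          field_simp]
      exact Complex.exp_int_mul_two_pi_mul_I n
    rw [geom_sum_eq h1, h2, sub_self, zero_div, mul_zero, mul_zero]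

/-- The Fourier expansion of the limit distribution at a rational time. -/
theorem hasSum_limitTerm_rational {l : ℝ} (hl : 0 < l) (σ : TestFun l) (D : ℝ≥0∞) (r : ℚ)
    (m s : ℝ) (x : ℝ × ℝ) :
    HasSum (limitTerm σ D r m s x) (revivalDist m l r.den D s x σ : ℂ) := by
  have h := (hasSum_sum (s := Finset.range (numPackets r.den)) fun k _ => hasSum_spreadDist σ hl D
    (x.1 + 2 * k * l / numPackets r.den + packetShift l r.den - x.2 / m * s) x.2).mul_left
      (1 / (numPackets r.den : ℂ))
  have e : (revivalDist m l r.den D s x σ : ℂ) = 1 / (numPackets r.den : ℂ) *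
      ∑ k ∈ Finset.range (numPackets r.den), (spreadDist l D
    (x.1 + 2 * k * l / numPackets r.den + packetShift l r.den - x.2 / m * s) x.2 σ : ℂ) := by
    simp [revivalDist]
  rw [e]
  refine h.congr_fun fun n => ?_
  rw [limitTerm, ← sum_exp_packets hl, Finset.mul_sum, Finset.mul_sum, Finset.mul_sum,
    Finset.sum_mul, Finset.sum_mul]
  refine Finset.sum_congr rfl fun k _ => ?_
  have : Complex.exp (freq l n * (x.1 + 2 * k * l / numPackets r.den + packetShift l r.den -
      x.2 / m * s : ℝ) * Complex.I) =
      Complex.exp (freq l n * (2 * k * l / numPackets r.den + packetShift l r.den : ℝ) *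
        Complex.I) * Complex.exp (freq l n * (x.1 - x.2 / m * s : ℝ) * Complex.I) := by
    rw [← Complex.exp_add]
    congr 1
    push_cast
    ring
  rw [this]
  ring

theorem resonance_of_irrational {c : ℝ} (hc : Irrational c) {n : ℤ} (hn : n ≠ 0) :
    resonance c n = 0 := by
  rw [resonance, if_neg]
  rintro ⟨j, hj⟩
  have hn' : (n : ℝ) ≠ 0 := by exact_mod_cast hn
  refine hc ⟨(j : ℚ) / (2 * n), ?_⟩
  push_cast
  rw [hj]
  field_simp

/-- At an irrational time only the mode `n = 0` is resonant, whatever the value of `D`. -/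
theorem hasSum_limitTerm_irrational {l : ℝ} (σ : TestFun l) (D : ℝ≥0∞) {c : ℝ}
    (hc : Irrational c) (m s : ℝ) (x : ℝ × ℝ) :
    HasSum (limitTerm σ D c m s x) (constDist l (1 / (2 * l)) x.2 σ : ℂ) := by
  have h : constDist l (1 / (2 * l)) x.2 σ = 1 / (2 * l) * ∫ q in (-l)..l, σ (q, x.2) := rfl
  refine (hasSum_ite_eq (0 : ℤ) ((constDist l (1 / (2 * l)) x.2 σ : ℝ) : ℂ)).congr_fun fun n => ?_
  rcases eq_or_ne n 0 with rfl | hn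
  · have h0 : resonance c 0 = 1 := by
      rw [resonance, if_pos ⟨0, by simp⟩]; simp
    rw [if_pos rfl, h, Complex.ofReal_mul, ← intervalIntegral.integral_ofReal, limitTerm, h0,
      fourierSlice]
    simp [spreadFactor, freq]
  · simp [limitTerm, hn, resonance_of_irrational hc hn]

end CircleCoherent

end

theorem theorem1 {ι : Type*} (F : Filter ι) (m l : ℝ) (hm : 0 < m) (hl : 0 < l)
    (hbar α t : ι → ℝ) (hhbar : ∀ i, 0 < hbar i) (hα : ∀ i, 0 < α i)
    (c : ℝ) (D : ℝ≥0∞)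
    (hlim_hbar : Tendsto hbar F (𝓝 0))
    (hlim_α : Tendsto α F (𝓝 0))
    (hlim_ratio : Tendsto (fun i => hbar i / α i) F (𝓝 0))
    (hlim_D : Tendsto
      (fun i => ((hbar i / α i * (t i - c * CircleCoherent.revivalTime (hbar i) m l) : ℝ) : EReal))
      F (𝓝 (((2 * m : ℝ) : EReal) * (D : EReal))))
    (hlim_c : Tendsto
      (fun i => hbar i * (t i - c * CircleCoherent.revivalTime (hbar i) m l)) F (𝓝 0)) :
    ∃ Q : ι → ℝ × ℝ → CircleCoherent.Distribution l,
      (∀ i x, CircleCoherent.HasDensity (Q i x)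
        (CircleCoherent.transitionDensity (hbar i) (α i) m l (t i) x)) ∧
      (∀ r : ℚ, (r : ℝ) = c → ∀ σ : CircleCoherent.TestFun l,
        TendstoUniformlyOn
          (fun i x => (Q i x - CircleCoherent.revivalDist m l r.den D
            (t i - c * CircleCoherent.revivalTime (hbar i) m l) x) σ)
          (fun _ => 0) F (CircleCoherent.strip l)) ∧
      (Irrational c → ∀ σ : CircleCoherent.TestFun l,
        TendstoUniformlyOn
          (fun i x => (Q i x - CircleCoherent.constDist l (1 / (2 * l)) x.2) σ)
          (fun _ => 0) F (CircleCoherent.strip l)) := by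
  choose Q hQ using fun (i : ι) (x : ℝ × ℝ) =>
    CircleCoherent.exists_distribution_transitionDensity hl (hhbar i) (hα i) m (t i) x
  -- Uniformity in `x` is convergence along `F ×ˢ 𝓟 (strip l)`, with `x` part of the index.
  have key : ∀ σ : CircleCoherent.TestFun l, Tendsto (fun y : ι × (ℝ × ℝ) =>
      ((Q y.1 y.2 σ : ℝ) : ℂ) - ∑' n, CircleCoherent.limitTerm σ D c m
        (t y.1 - c * CircleCoherent.revivalTime (hbar y.1) m l) y.2 n)
      (F ×ˢ 𝓟 (CircleCoherent.strip l)) (𝓝 0) := by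
    intro σ
    have hfst : Tendsto (Prod.fst : ι × (ℝ × ℝ) → ι) (F ×ˢ 𝓟 (CircleCoherent.strip l)) F :=
      tendsto_fst
    have h := CircleCoherent.tendsto_pairing_sub_tsum_limitTerm (x := Prod.snd) hl hm
      (fun y : ι × (ℝ × ℝ) => hhbar y.1) (fun y => hα y.1) (hlim_α.comp hfst)
      (hlim_ratio.comp hfst) (hlim_D.comp hfst) (hlim_c.comp hfst) σ
    refine h.congr fun y => ?_
    rw [(hQ y.1 y.2 σ).2]
  have uniform : ∀ (σ : CircleCoherent.TestFun l)
      (T : ι → ℝ × ℝ → CircleCoherent.Distribution l),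
      (∀ i x, HasSum (CircleCoherent.limitTerm σ D c m
        (t i - c * CircleCoherent.revivalTime (hbar i) m l) x) (T i x σ : ℂ)) →
      TendstoUniformlyOn (fun i x => (Q i x - T i x) σ) (fun _ => 0) F
        (CircleCoherent.strip l) := by
    intro σ T hT
    rw [tendstoUniformlyOn_iff_tendsto]
    refine tendsto_uniformity_iff_dist_tendsto_zero.2 ?_
    have h := (key σ).norm
    rw [norm_zero] at h
    refine h.congr fun y => ?_
    rw [(hT y.1 y.2).tsum_eq, ← Complex.ofReal_sub, Complex.norm_real, dist_comm, dist_zero_right]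
    rfl
  refine ⟨Q, hQ, ?_, ?_⟩
  · rintro r rfl σ
    exact uniform σ _ fun i x => CircleCoherent.hasSum_limitTerm_rational hl σ D r m _ x
  · intro hc σ
    exact uniform σ _ fun i x => CircleCoherent.hasSum_limitTerm_irrational σ D hc m _ x
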